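/- **Model.** A configuration $(G,x)$ consists of a finite connected simple graph $G$ on $n\ge 1$ nodes, pairwise distinct identities $\mathrm{id}(v)\in\{1,\dots,N(n)\}$, a local input $x(v)$ at each node, encoded by a natural number at most $X(n)$, and, if $G$ is weighted, a weight $w(e)\in\{0,\dots,W(n)\}$ on every edge. Here $N,X,W$ are fixed functions bounded by polynomials. A distributed language is a set of configurations; complements are taken within the configurations obeying these bounds. A labelling assigns a bit string to each node. A local algorithm $A$ is given by a constant $t$ and a computable function that maps the radius-$t$ view of a node $v$ (the subgraph induced by the nodes at distance at most $t$ from $v$, with all identities, inputs, weights and labels) to accept or reject; $A$ accepts iff all nodes accept. A language $L$ is in $\Sigma_k$ if there are a constant $c$ and a local algorithm $A$ such that, for all configurations obeying the bounds (in particular for all identity assignments), $$(G,x)\in L\iff \exists \ell_1\,\forall \ell_2\,\exists\ell_3\cdots Q\,\ell_k:\ A \text{ accepts } (G,x,\ell_1,\dots,\ell_k),$$ where the quantifiers alternate and range over labellings with at most $c\log_2 n$ bits per node. The class $\Pi_k$ is defined in the same way with $\forall$ as first quantifier. Put $\Lambda_k=\Sigma_k$ for $k$ odd, $\Lambda_k=\Pi_k$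 for $k$ even, and $\text{co-}\Lambda_k=\{L:\overline{L}\in\Lambda_k\}$. **Languages.** SPANNING TREE: $x$ encodes a spanning tree $T$ of $G$ with some root $r$, i.e. $x(r)=\bot$ and, for $v\ne r$, $x(v)$ is the identity of the parent of $v$ in $T$. MST (weighted graphs): $x$ encodes in this way a spanning tree of minimum total weight. HAMILTONIAN CYCLE: $x$ encodes a Hamiltonian cycle $C$ of $G$, i.e. $x(u)$ is the pair, in some order, of the two edges of $C$ incident to $u$, each given by the identity of its other endpoint. TRAVELLING SALESMAN (weighted graphs): $x$ encodes in this way a Hamiltonian cycle of minimum total weight among all Hamiltonian cycles of $G$. **Corollary.** Let $N,X,W:\mathbb N\to\mathbb N$ be bounded by polynomials. Then, for the configurations obeying the bounds $N,X,W$: 1. MST $\in\text{co-}\Lambda_1$ and TRAVELLING SALESMAN $\in\text{co-}\Lambda_1$. 2. MST $\in\Lambda_2=\Pi_2$ and TRAVELLING SALESMAN $\in\Lambda_2=\Pi_2$; that is, both have $\Pi_2$-protocols with $O(\log n)$-bit certificates. 3. For unweighted graphs, SPANNING TREE $\in\Lambda_1\cap\text{co-}\Lambda_1$ and HAMILTONIAN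 CYCLE $\in\Lambda_1\cap\text{co-}\Lambda_1$. -/

import Mathlib

namespace LocalDecision

/-- A configuration: a connected simple graph on `n` nodes, with pairwise distinct identities,
a datum of type `E` on every edge (`E = Unit` for unweighted graphs, `E = ℕ` for weighted graphs)
and a local input of type `I` at every node.  The values of `edgeData` off the edge set of the
graph are irrelevant. -/
structure Config (E I : Type) where
  n : ℕ
  graph : SimpleGraph (Fin n)
  connected : graph.Connected
  ident : Fin n → ℕ
  ident_injective : Function.Injective ident
  edgeData : Sym2 (Fin n) → E
  input : Fin n → I

/-- A distributed language: a set of configurations. -/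
abbrev Language (E I : Type) := Set (Config E I)

/-- A labelling assigns a bit string to every node. -/
abbrev Labelling (n : ℕ) := Fin n → List Bool

/-- What is known about one node of a view: its identity, its input, its labels
`ℓ₁(v), …, ℓₖ(v)`, and the list of its neighbours inside the view (identity of the neighbour,
datum of the connecting edge), sorted by identity. -/
abbrev NodeRecord (E I : Type) := ℕ × I × List (List Bool) × List (ℕ × E)

/-- A labelled local neighbourhood: the identity of its centre, and the records of its nodes,
sorted by identity. -/
abbrev View (E I : Type) := ℕ × List (NodeRecord E I)

section Views

variable {E I : Type} (C : Config E I)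

open Classical in
/-- The nodes at distance at most `t` from `v`, sorted by identity. -/
noncomputable def Config.ball (t : ℕ) (v : Fin C.n) : List (Fin C.n) :=
  ((List.finRange C.n).filter fun u => decide (C.graph.dist v u ≤ t)).mergeSort
    fun u w => decide (C.ident u ≤ C.ident w)

open Classical in
/-- The radius-`t` view of `v` in `C` labelled with `ls`: the subgraph induced by the nodes at
distance at most `t` from `v`, with all identities, inputs, edge data and labels, presented
canonically through the identities. -/
noncomputable def Config.view (ls : List (Labelling C.n)) (t : ℕ) (v : Fin C.n) : View E I :=
  (C.ident v, (C.ball t v).map fun u =>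
    (C.ident u, C.input u, ls.map (fun l => l u),
      ((C.ball t v).filter fun w => decide (C.graph.Adj u w)).map
        fun w => (C.ident w, C.edgeData s(u, w))))

/-- The algorithm `A`, run for `t` rounds, accepts `C` labelled with `ls`: every node accepts. -/
def Config.Accepts (t : ℕ) (A : View E I → Bool) (ls : List (Labelling C.n)) : Prop :=
  ∀ v : Fin C.n, A (C.view ls t v) = true

/-- The labellings all of whose labels have at most `c * log₂ n` bits. -/
def shortLabellings (c n : ℕ) : Set (Labelling n) :=
  {l | ∀ v, ((l v).length : ℝ) ≤ c * Real.logb 2 n}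

end Views

/-- `Alternation S b k P` is `Q₁ ℓ₁ ∈ S, Q₂ ℓ₂ ∈ S, …, Qₖ ℓₖ ∈ S, P [ℓ₁, …, ℓₖ]`, where the
quantifiers alternate and `Q₁` is `∃` if `b = true` and `∀` if `b = false`. -/
def Alternation {α : Type} (S : Set α) : Bool → ℕ → (List α → Prop) → Prop
  | _, 0, P => P []
  | true, k + 1, P => ∃ l ∈ S, Alternation S false k fun ls => P (l :: ls)
  | false, k + 1, P => ∀ l ∈ S, Alternation S true k fun ls => P (l :: ls)

section Classes

variable {E I : Type} [Primcodable E] [Primcodable I]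

/-- `L` is decided, on the instances in `𝓘`, by a local algorithm (a computable function of the
radius-`t` views) with `k` alternating quantifiers over labellings of size at most `c * log₂ n`,
the first of which is existential if `b = true` and universal if `b = false`. -/
def Decided (𝓘 : Set (Config E I)) (b : Bool) (k : ℕ) (L : Language E I) : Prop :=
  ∃ (c t : ℕ) (A : View E I → Bool), Computable A ∧ ∀ C ∈ 𝓘,
    (C ∈ L ↔ Alternation (shortLabellings c C.n) b k (C.Accepts t A))

/-- The class `Σₖ` over the instances in `𝓘`. -/
def SigmaClass (𝓘 : Set (Config E I)) (k : ℕ) : Set (Language E I) :=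
  {L | Decided 𝓘 true k L}

/-- The class `Πₖ` over the instances in `𝓘`. -/
def PiClass (𝓘 : Set (Config E I)) (k : ℕ) : Set (Language E I) :=
  {L | Decided 𝓘 false k L}

/-- The class `Λₖ`: it is `Σₖ` for odd `k` and `Πₖ` for even `k`. -/
def LambdaClass (𝓘 : Set (Config E I)) (k : ℕ) : Set (Language E I) :=
  if Odd k then SigmaClass 𝓘 k else PiClass 𝓘 k

/-- The class `co-Λₖ` of the languages whose complement is in `Λₖ`. -/
def coLambdaClass (𝓘 : Set (Config E I)) (k : ℕ) : Set (Language E I) :=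
  {L | Lᶜ ∈ LambdaClass 𝓘 k}

/-- The instances in which the identities are in `{1, …, N n}`, the inputs (as encoded by natural
numbers) are at most `X n`, and the edge data (as encoded by natural numbers; the encoding of a
natural number is the number itself) are at most `W n`, where `n` is the number of nodes. -/
def boundedInstances (E I : Type) [Primcodable E] [Primcodable I] (N X W : ℕ → ℕ) :
    Set (Config E I) :=
  {C | (∀ v, 1 ≤ C.ident v ∧ C.ident v ≤ N C.n) ∧
    (∀ v, Encodable.encode (C.input v) ≤ X C.n) ∧
    ∀ e ∈ C.graph.edgeSet, Encodable.encode (C.edgeData e) ≤ W C.n}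

end Classes

/-- `f` is bounded by a polynomial. -/
def PolyBounded (f : ℕ → ℕ) : Prop :=
  ∃ p : Polynomial ℕ, ∀ n, f n ≤ p.eval n

section Languages

variable {E : Type}

/-- `T` is a spanning tree of the graph. -/
def Config.IsSpanningTree {I : Type} (C : Config E I) (T : SimpleGraph (Fin C.n)) : Prop :=
  T ≤ C.graph ∧ T.IsTree

/-- The input encodes the tree `T`, rooted at some node `r`: the input of `r` is `⊥` and the
input of any other node is the identity of its parent. -/
def Config.EncodesTree (C : Config E (Option ℕ)) (T : SimpleGraph (Fin C.n)) : Prop :=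
  ∃ r, C.input r = none ∧ ∀ v, v ≠ r →
    ∃ p, T.Adj v p ∧ T.dist v r = T.dist p r + 1 ∧ C.input v = some (C.ident p)

open Classical in
/-- The total weight of the edges of `T`. -/
noncomputable def Config.treeWeight {I : Type} (C : Config ℕ I)
    (T : SimpleGraph (Fin C.n)) : ℕ :=
  ∑ e ∈ T.edgeFinset, C.edgeData e

/-- The language SPANNING TREE. -/
def spanningTree (E : Type) : Language E (Option ℕ) :=
  {C | ∃ T, C.IsSpanningTree T ∧ C.EncodesTree T}

/-- The language MST. -/
def mst : Language ℕ (Option ℕ) :=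
  {C | ∃ T, C.IsSpanningTree T ∧ C.EncodesTree T ∧
    ∀ T', C.IsSpanningTree T' → C.treeWeight T ≤ C.treeWeight T'}

/-- The input of every node `u` is the pair of the two edges of the cycle `p` incident to `u`,
in some order, each of them given by the identity of its other endpoint. -/
def Config.EncodesCycle (C : Config E (ℕ × ℕ)) {v : Fin C.n} (p : C.graph.Walk v v) : Prop :=
  ∀ u, ∃ a b, a ≠ b ∧ s(u, a) ∈ p.edges ∧ s(u, b) ∈ p.edges ∧
    C.input u = (C.ident a, C.ident b)

/-- The total weight of the edges of `p`. -/
def Config.walkWeight {I : Type} (C : Config ℕ I) {u v : Fin C.n} (p : C.graph.Walk u v) : ℕ :=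
  (p.edges.map C.edgeData).sum

/-- The language HAMILTONIAN CYCLE. -/
def hamiltonianCycle (E : Type) : Language E (ℕ × ℕ) :=
  {C | ∃ (v : Fin C.n) (p : C.graph.Walk v v), p.IsHamiltonianCycle ∧ C.EncodesCycle p}

/-- The language TRAVELLING SALESMAN. -/
def travellingSalesman : Language ℕ (ℕ × ℕ) :=
  {C | ∃ (v : Fin C.n) (p : C.graph.Walk v v), p.IsHamiltonianCycle ∧ C.EncodesCycle p ∧
    ∀ (u : Fin C.n) (q : C.graph.Walk u u), q.IsHamiltonianCycle →
      C.walkWeight p ≤ C.walkWeight q}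

end Languages

end LocalDecision

namespace LocalDecision

/-! Everything reduces to `Certifiable`: a property verified by polynomially bounded numerical
labels and a primitive recursive test on the star of each node. Such labels have O(log n) bits, so
`mem_sigmaClass_one` turns certificates into Σ₁-protocols, and `mem_piClass_two` does the same after
one universal labelling. This works for n ≥ 2; at n = 1 labels are empty, and the lone node, which
sees no neighbour, is judged by its input.

Certifiable properties are closed under conjunction (pair the labels), disjunction (a tag on which
all nodes agree) and guessing of bounded labels. Existence of a special node is certified by
distances to it, a spanning tree by depths and the identity of the root. A non-tree has a bad
pointer, two roots, or a nonempty set of nodes whose pointers stay inside it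
(`not_mem_spanningTree_iff`). A pair input is a Hamiltonian cycle iff every node has two mutual
pointers and the graph of mutual pointers is connected (`mem_hamiltonianCycle_iff`), since a finite
connected 2-regular graph is a cycle; connectedness is certified by distances, its failure by a
two-colouring.

Two global sums are compared by guessing a spanning tree and adding up along it towards the root,
which makes the comparison (`certifiable_sum_rel`). The weight of a solution is such a sum, up to a
factor two for cycles. Non-optimality is infeasibility or a guessed cheaper solution
(`certifiable_not_optimal`). For Π₂ the universal labelling proposes a rival, and the reply
certifies that the input is feasible and the rival infeasible or no cheaper
(`optimal_mem_piClass_two`). -/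

variable {E I J K : Type}

/-! ### Primitive recursive predicates on lists. -/

section Primrec

variable {α β γ σ : Type*} [Primcodable α] [Primcodable β] [Primcodable γ] [Primcodable σ]

theorem primrecPred_exists_mem {l : α → List β} {p : α → β → Prop} (hl : Primrec l)
    (hp : PrimrecPred fun q : α × β => p q.1 q.2) : PrimrecPred fun a => ∃ b ∈ l a, p a b :=
  PrimrecRel.comp (R := fun (l : List β) (a : α) => ∃ b ∈ l, p a b)
    (PrimrecRel.exists_mem_list (R := fun b a => p a b)
      (hp.comp (Primrec.pair Primrec.snd Primrec.fst))) hl Primrec.id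

theorem primrecPred_forall_mem {l : α → List β} {p : α → β → Prop} (hl : Primrec l)
    (hp : PrimrecPred fun q : α × β => p q.1 q.2) : PrimrecPred fun a => ∀ b ∈ l a, p a b :=
  PrimrecRel.comp (R := fun (l : List β) (a : α) => ∀ b ∈ l, p a b)
    (PrimrecRel.forall_mem_list (R := fun b a => p a b)
      (hp.comp (Primrec.pair Primrec.snd Primrec.fst))) hl Primrec.id

theorem primrecPred_imp {p q : α → Prop} (hp : PrimrecPred p) (hq : PrimrecPred q) :
    PrimrecPred fun a => p a → q a :=
  (hp.not.or hq).of_eq fun _ => imp_iff_not_or.symm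

theorem primrec_list_sum : Primrec (List.sum : List ℕ → ℕ) :=
  (Primrec.list_foldr (h := fun (_ : List ℕ) (p : ℕ × ℕ) => p.1 + p.2) Primrec.id
    (Primrec.const 0)
    (Primrec.nat_add.comp (Primrec.fst.comp Primrec.snd)
      (Primrec.snd.comp Primrec.snd)).to₂).of_eq fun l => by
    simp only [id, List.sum_eq_foldr]

theorem primrec_sum_map {l : α → List β} {g : α → β → ℕ} (hl : Primrec l)
    (hg : Primrec fun q : α × β => g q.1 q.2) : Primrec fun a => ((l a).map (g a)).sum :=
  primrec_list_sum.comp (Primrec.list_map hl hg)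

end Primrec

/-! ### Polynomial bounds. -/

section PolyBounded

theorem PolyBounded.mono {f g : ℕ → ℕ} (hg : PolyBounded g) (h : ∀ n, f n ≤ g n) :
    PolyBounded f :=
  let ⟨p, hp⟩ := hg
  ⟨p, fun n => (h n).trans (hp n)⟩

theorem PolyBounded.const (k : ℕ) : PolyBounded fun _ => k := ⟨Polynomial.C k, by simp⟩

theorem PolyBounded.id : PolyBounded fun n => n := ⟨Polynomial.X, by simp⟩

theorem PolyBounded.add {f g : ℕ → ℕ} (hf : PolyBounded f) (hg : PolyBounded g) :
    PolyBounded fun n => f n + g n := by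
  obtain ⟨p, hp⟩ := hf
  obtain ⟨q, hq⟩ := hg
  exact ⟨p + q, fun n => by simpa using add_le_add (hp n) (hq n)⟩

theorem PolyBounded.mul {f g : ℕ → ℕ} (hf : PolyBounded f) (hg : PolyBounded g) :
    PolyBounded fun n => f n * g n := by
  obtain ⟨p, hp⟩ := hf
  obtain ⟨q, hq⟩ := hg
  exact ⟨p * q, fun n => by simpa using Nat.mul_le_mul (hp n) (hq n)⟩

/-- `Nat.pair` grows only quadratically, so several labels can be packed into one without leaving
polynomial size. -/
theorem PolyBounded.pair {f g : ℕ → ℕ} (hf : PolyBounded f) (hg : PolyBounded g) :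
    PolyBounded fun n => Nat.pair (f n) (g n) := by
  have h := (hf.add hg).add (.const 1)
  refine (h.mul h).mono fun n => (Nat.pair_lt_max_add_one_sq _ _).le.trans ?_
  rw [sq]
  have : max (f n) (g n) ≤ f n + g n := by omega
  gcongr

theorem pair_le_pair {a b c d : ℕ} (h₁ : a ≤ c) (h₂ : b ≤ d) : Nat.pair a b ≤ Nat.pair c d := by
  rcases h₁.eq_or_lt with rfl | h₁ <;> rcases h₂.eq_or_lt with rfl | h₂
  · rfl
  · exact (Nat.pair_lt_pair_right _ h₂).le
  · exact (Nat.pair_lt_pair_left _ h₁).le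
  · exact ((Nat.pair_lt_pair_left _ h₁).trans (Nat.pair_lt_pair_right _ h₂)).le

/-- The sum of the coefficients is `p.eval 1`, and for n ≥ 2 it is absorbed by n to that same power.
-/
theorem PolyBounded.exists_le_pow {f : ℕ → ℕ} (hf : PolyBounded f) :
    ∃ a, ∀ n, 2 ≤ n → f n ≤ n ^ a := by
  obtain ⟨p, hp⟩ := hf
  refine ⟨p.eval 1 + p.natDegree, fun n hn => (hp n).trans ?_⟩
  rw [Polynomial.eval_eq_sum_range, Polynomial.eval_eq_sum_range]
  calc ∑ i ∈ Finset.range (p.natDegree + 1), p.coeff i * n ^ i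
      ≤ ∑ i ∈ Finset.range (p.natDegree + 1), p.coeff i * n ^ p.natDegree := by
        refine Finset.sum_le_sum fun i hi => Nat.mul_le_mul_left _ ?_
        exact Nat.pow_le_pow_right (by omega) (by simpa [Nat.lt_succ_iff] using hi)
    _ = (∑ i ∈ Finset.range (p.natDegree + 1), p.coeff i * 1 ^ i) * n ^ p.natDegree := by
        simp [Finset.sum_mul]
    _ ≤ n ^ (∑ i ∈ Finset.range (p.natDegree + 1), p.coeff i * 1 ^ i) * n ^ p.natDegree :=
        Nat.mul_le_mul_right _ (Nat.lt_pow_self hn).le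
    _ = _ := (pow_add _ _ _).symm

end PolyBounded

/-! ### Changing inputs, and stars. -/

/-- The configuration `C` with its inputs replaced by `x`. -/
abbrev Config.setInput (C : Config E I) (x : Fin C.n → J) : Config E J where
  n := C.n
  graph := C.graph
  connected := C.connected
  ident := C.ident
  ident_injective := C.ident_injective
  edgeData := C.edgeData
  input := x

/-- The configuration `C` with `l v` adjoined to the input of every node `v`. -/
abbrev Config.label (C : Config E I) (l : Fin C.n → J) : Config E (I × J) :=
  C.setInput fun v => (C.input v, l v)

/-- The configuration `C` with `f` applied to all inputs. -/
abbrev Config.mapInput (C : Config E I) (f : I → J) : Config E J :=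
  C.setInput fun v => f (C.input v)

open Classical in
/-- The neighbours of `v`, sorted by identity. -/
noncomputable def Config.nbrs (C : Config E I) (v : Fin C.n) : List (Fin C.n) :=
  (C.ball 1 v).filter fun w => decide (C.graph.Adj v w)

/-- What a node sees within distance one, apart from the edges between its neighbours: its own
identity and input, and the list of the data of the edges to its neighbours with the identities and
inputs of these. -/
abbrev Star (E I : Type) := (ℕ × I) × List (E × ℕ × I)

/-- The star of the node `v`. -/
noncomputable def Config.star (C : Config E I) (v : Fin C.n) : Star E I :=
  ((C.ident v, C.input v), (C.nbrs v).map fun u => (C.edgeData s(v, u), C.ident u, C.input u))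

/-- Apply `f` to all inputs in a star. -/
def Star.map (f : I → J) (s : Star E I) : Star E J :=
  ((s.1.1, f s.1.2), s.2.map fun q => (q.1, q.2.1, f q.2.2))

theorem Config.star_mapInput (C : Config E I) (f : I → J) (v : Fin C.n) :
    (C.mapInput f).star v = (C.star v).map f := by
  simp only [Config.star, Star.map, List.map_map]
  rfl

theorem Config.map_star_label (C : Config E I) {l : Fin C.n → J} {f : I × J → K}
    {x : Fin C.n → K} (h : ∀ v, f (C.input v, l v) = x v) (v : Fin C.n) :
    ((C.label l).star v).map f = (C.setInput x).star v := by
  obtain rfl : (fun v => f (C.input v, l v)) = x := funext h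
  exact ((C.label l).star_mapInput f v).symm

theorem Config.mem_ball (C : Config E I) (t : ℕ) (v u : Fin C.n) :
    u ∈ C.ball t v ↔ C.graph.dist v u ≤ t := by
  simp [Config.ball]

theorem Config.nodup_ball (C : Config E I) (t : ℕ) (v : Fin C.n) : (C.ball t v).Nodup := by
  unfold Config.ball
  rw [(List.mergeSort_perm _ _).nodup_iff]
  exact (List.nodup_finRange _).filter _

theorem Config.mem_nbrs (C : Config E I) (v u : Fin C.n) :
    u ∈ C.nbrs v ↔ C.graph.Adj v u := by
  simp only [Config.nbrs, List.mem_filter, C.mem_ball, decide_eq_true_eq, and_iff_right_iff_imp]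
  intro h
  exact (SimpleGraph.dist_eq_one_iff_adj.2 h).le

theorem Config.nodup_nbrs (C : Config E I) (v : Fin C.n) : (C.nbrs v).Nodup :=
  (C.nodup_ball 1 v).filter _

theorem Config.exists_mem_star (C : Config E I) (v : Fin C.n) {p : E × ℕ × I → Prop} :
    (∃ q ∈ (C.star v).2, p q) ↔
      ∃ u, C.graph.Adj v u ∧ p (C.edgeData s(v, u), C.ident u, C.input u) := by
  simp [Config.star, C.mem_nbrs]

theorem Config.forall_mem_star (C : Config E I) (v : Fin C.n) {p : E × ℕ × I → Prop} :
    (∀ q ∈ (C.star v).2, p q) ↔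
      ∀ u, C.graph.Adj v u → p (C.edgeData s(v, u), C.ident u, C.input u) := by
  simp [Config.star, C.mem_nbrs]

open Classical in
theorem Config.sum_star (C : Config E I) (v : Fin C.n) (g : E × ℕ × I → ℕ) :
    ((C.star v).2.map g).sum =
      ∑ u, if C.graph.Adj v u then g (C.edgeData s(v, u), C.ident u, C.input u) else 0 := by
  rw [← Finset.sum_filter, Config.star, List.map_map, ← List.sum_toFinset _ (C.nodup_nbrs v)]
  refine Finset.sum_congr ?_ fun _ _ => rfl
  ext u
  simp [C.mem_nbrs]

section StarPrimrec

variable [Primcodable E] [Primcodable I] [Primcodable J]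

theorem Star.primrec_map {f : I → J} (hf : Primrec f) :
    Primrec (Star.map f : Star E I → Star E J) := by
  refine Primrec.pair (Primrec.pair (Primrec.fst.comp Primrec.fst)
    (hf.comp (Primrec.snd.comp Primrec.fst))) (Primrec.list_map Primrec.snd ?_)
  have h : Primrec fun q : Star E I × (E × ℕ × I) => q.2 := Primrec.snd
  exact Primrec.pair (Primrec.fst.comp h) (Primrec.pair (Primrec.fst.comp (Primrec.snd.comp h))
    (hf.comp (Primrec.snd.comp (Primrec.snd.comp h))))

end StarPrimrec

/-! ### Locally checkable certificates and their closure properties. -/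

/-- `C` has at least two nodes, identities at most `N n`, and edge data at most `W n`. -/
def Config.Admissible [Encodable E] (N W : ℕ → ℕ) (C : Config E I) : Prop :=
  2 ≤ C.n ∧ (∀ v, C.ident v ≤ N C.n) ∧
    ∀ e ∈ C.graph.edgeSet, Encodable.encode (C.edgeData e) ≤ W C.n

/-- On admissible configurations, `Q` holds iff there are labels that a primitive recursive
predicate of the labelled stars accepts everywhere, and then these can be taken polynomially
bounded. -/
def Certifiable [Primcodable E] [Primcodable I] (N W : ℕ → ℕ) (Q : Config E I → Prop) : Prop :=
  ∃ (B : ℕ → ℕ) (P : Star E (I × ℕ) → Prop), PolyBounded B ∧ PrimrecPred P ∧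
    ∀ C : Config E I, C.Admissible N W →
      (∀ l : Fin C.n → ℕ, (∀ v, P ((C.label l).star v)) → Q C) ∧
      (Q C → ∃ l : Fin C.n → ℕ, (∀ v, l v ≤ B C.n) ∧ ∀ v, P ((C.label l).star v))

/-- Connectedness turns a comparison with neighbours into global agreement; tags and root identities
are checked this way. -/
theorem Config.eq_of_adj_imp_eq (C : Config E I) {f : Fin C.n → K}
    (h : ∀ u v, C.graph.Adj u v → f u = f v) (u v : Fin C.n) : f u = f v := by
  obtain ⟨w⟩ := C.connected.preconnected u v
  induction w with
  | nil => rfl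
  | cons h' _ ih => exact (h _ _ h').trans ih

theorem exists_adj_dist_succ {V : Type*} {G : SimpleGraph V} (hG : G.Connected) {v r : V}
    (h : v ≠ r) : ∃ p, G.Adj v p ∧ G.dist v r = G.dist p r + 1 := by
  obtain ⟨w, hw⟩ := hG.exists_walk_length_eq_dist v r
  cases w with
  | nil => exact absurd rfl h
  | @cons _ p _ h' w =>
    refine ⟨p, h', le_antisymm ?_ ?_⟩
    · have := hG.dist_triangle (u := v) (v := p) (w := r)
      rw [SimpleGraph.dist_eq_one_iff_adj.2 h'] at this
      omega
    · rw [← hw, SimpleGraph.Walk.length_cons]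
      have := SimpleGraph.dist_le w
      omega

theorem dist_lt_card {V : Type*} [Fintype V] {G : SimpleGraph V} (hG : G.Connected) (u v : V) :
    G.dist u v < Fintype.card V := by
  obtain ⟨w, hp, hw⟩ := hG.exists_path_of_dist u v
  exact hw ▸ hp.length_lt

namespace Certifiable

variable [Primcodable E] [Primcodable I] [Primcodable J] {N W : ℕ → ℕ}
  {Q₁ Q₂ : Config E I → Prop}

protected theorem congr (h : Certifiable N W Q₁) (hQ : ∀ C, C.Admissible N W → (Q₁ C ↔ Q₂ C)) :
    Certifiable N W Q₂ := by
  obtain ⟨B, P, hB, hP, h⟩ := h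
  refine ⟨B, P, hB, hP, fun C hC => ?_⟩
  rw [← hQ C hC]
  exact h C hC

theorem forall_node {P : Star E I → Prop} (hP : PrimrecPred P) :
    Certifiable N W fun C => ∀ v, P (C.star v) := by
  refine ⟨fun _ => 0, fun s => P (s.map Prod.fst), .const 0,
    hP.comp (Star.primrec_map Primrec.fst), fun C _ => ?_⟩
  simp only [← Config.star_mapInput]
  exact ⟨fun _ h => h, fun h => ⟨fun _ => 0, fun _ => le_rfl, h⟩⟩

/-- Labels are distances to a witness. Conversely, a node of minimal label has no neighbour with a
smaller one, so it must itself be a witness. -/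
theorem exists_node {P : Star E I → Prop} (hP : PrimrecPred P) :
    Certifiable N W fun C => ∃ v, P (C.star v) := by
  refine ⟨fun n => n, fun s => (s.1.2.2 = 0 ∧ P (s.map Prod.fst)) ∨
    ∃ q ∈ s.2, q.2.2.2 < s.1.2.2, .id, ?_, fun C _ => ⟨fun l h => ?_, ?_⟩⟩
  · have hd : Primrec fun s : Star E (I × ℕ) => s.1.2.2 :=
      Primrec.snd.comp (Primrec.snd.comp Primrec.fst)
    refine ((Primrec.eq.comp hd (Primrec.const 0)).and
      (hP.comp (Star.primrec_map Primrec.fst))).or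
      (primrecPred_exists_mem Primrec.snd (Primrec.nat_lt.comp ?_ (hd.comp Primrec.fst)))
    exact Primrec.snd.comp (Primrec.snd.comp (Primrec.snd.comp Primrec.snd))
  · simp only [← Config.star_mapInput, Config.exists_mem_star] at h
    have : Nonempty (Fin C.n) := C.connected.nonempty
    obtain ⟨v, -, hv⟩ := Finset.exists_min_image Finset.univ l Finset.univ_nonempty
    rcases h v with h | ⟨u, -, hu⟩
    · exact ⟨v, h.2⟩
    · exact absurd hu (hv u (Finset.mem_univ _)).not_gt
  · rintro ⟨r, hr⟩
    refine ⟨fun v => C.graph.dist v r, fun v => ?_, fun (v : Fin C.n) => ?_⟩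
    · simpa using (dist_lt_card C.connected v r).le
    · by_cases hv : v = r
      · rw [hv]
        refine Or.inl ⟨SimpleGraph.dist_self, ?_⟩
        exact (congrArg P (C.map_star_label (x := C.input) (fun _ => rfl) r)).mpr hr
      · obtain ⟨p, hp, hd⟩ := exists_adj_dist_succ C.connected hv
        exact Or.inr <| (Config.exists_mem_star (C.label _) v).2 ⟨p, hp,
          (Nat.lt_succ_self _).trans_eq hd.symm⟩

theorem comap {Q : Config E J → Prop} (h : Certifiable N W Q) {f : I → J} (hf : Primrec f) :
    Certifiable N W fun C : Config E I => Q (C.mapInput f) := by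
  obtain ⟨B, P, hB, hP, h⟩ := h
  have hg : Primrec fun p : I × ℕ => (f p.1, p.2) :=
    Primrec.pair (hf.comp Primrec.fst) Primrec.snd
  refine ⟨B, fun s => P (s.map fun p => (f p.1, p.2)), hB, hP.comp (Star.primrec_map hg),
    fun C hC => ?_⟩
  simp only [← Config.star_mapInput]
  exact h (C.mapInput f) hC

protected theorem and (h₁ : Certifiable N W Q₁) (h₂ : Certifiable N W Q₂) :
    Certifiable N W fun C => Q₁ C ∧ Q₂ C := by
  obtain ⟨B₁, P₁, hB₁, hP₁, h₁⟩ := h₁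
  obtain ⟨B₂, P₂, hB₂, hP₂, h₂⟩ := h₂
  have hg₁ : Primrec fun p : I × ℕ => (p.1, p.2.unpair.1) :=
    Primrec.pair Primrec.fst (Primrec.fst.comp (Primrec.unpair.comp Primrec.snd))
  have hg₂ : Primrec fun p : I × ℕ => (p.1, p.2.unpair.2) :=
    Primrec.pair Primrec.fst (Primrec.snd.comp (Primrec.unpair.comp Primrec.snd))
  refine ⟨fun n => Nat.pair (B₁ n) (B₂ n),
    fun s => P₁ (s.map fun p => (p.1, p.2.unpair.1)) ∧ P₂ (s.map fun p => (p.1, p.2.unpair.2)),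
    hB₁.pair hB₂, (hP₁.comp (Star.primrec_map hg₁)).and (hP₂.comp (Star.primrec_map hg₂)),
    fun C hC => ⟨fun l h => ?_, ?_⟩⟩
  · simp only [← Config.star_mapInput] at h
    exact ⟨(h₁ C hC).1 (fun v => (l v).unpair.1) fun v => (h v).1,
      (h₂ C hC).1 (fun v => (l v).unpair.2) fun v => (h v).2⟩
  · rintro ⟨q₁, q₂⟩
    obtain ⟨l₁, b₁, a₁⟩ := (h₁ C hC).2 q₁
    obtain ⟨l₂, b₂, a₂⟩ := (h₂ C hC).2 q₂
    refine ⟨fun v => Nat.pair (l₁ v) (l₂ v), fun v => pair_le_pair (b₁ v) (b₂ v), fun v => ?_⟩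
    have e₁ := C.map_star_label (l := fun v => Nat.pair (l₁ v) (l₂ v))
      (f := fun p => (p.1, p.2.unpair.1)) (x := fun v => (C.input v, l₁ v)) (by simp) v
    have e₂ := C.map_star_label (l := fun v => Nat.pair (l₁ v) (l₂ v))
      (f := fun p => (p.1, p.2.unpair.2)) (x := fun v => (C.input v, l₂ v)) (by simp) v
    exact ⟨e₁ ▸ a₁ v, e₂ ▸ a₂ v⟩

/-- The first half of the label tells which disjunct is being certified. The nodes check that it is
constant, so they cannot mix the two certificates. -/
protected theorem or (h₁ : Certifiable N W Q₁) (h₂ : Certifiable N W Q₂) :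
    Certifiable N W fun C => Q₁ C ∨ Q₂ C := by
  obtain ⟨B₁, P₁, hB₁, hP₁, h₁⟩ := h₁
  obtain ⟨B₂, P₂, hB₂, hP₂, h₂⟩ := h₂
  have hg : Primrec fun p : I × ℕ => (p.1, p.2.unpair.2) :=
    Primrec.pair Primrec.fst (Primrec.snd.comp (Primrec.unpair.comp Primrec.snd))
  refine ⟨fun n => Nat.pair 1 (B₁ n + B₂ n),
    fun s => (∀ q ∈ s.2, q.2.2.2.unpair.1 = s.1.2.2.unpair.1) ∧
      ((s.1.2.2.unpair.1 = 0 ∧ P₁ (s.map fun p => (p.1, p.2.unpair.2))) ∨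
        (s.1.2.2.unpair.1 ≠ 0 ∧ P₂ (s.map fun p => (p.1, p.2.unpair.2)))),
    (PolyBounded.const 1).pair (hB₁.add hB₂), ?_, fun C hC => ⟨fun l h => ?_, ?_⟩⟩
  · have ht : Primrec fun s : Star E (I × ℕ) => s.1.2.2.unpair.1 :=
      Primrec.fst.comp (Primrec.unpair.comp (Primrec.snd.comp (Primrec.snd.comp Primrec.fst)))
    have h0 := Primrec.eq.comp ht (Primrec.const 0)
    have hm := Star.primrec_map (E := E) hg
    refine (primrecPred_forall_mem Primrec.snd (Primrec.eq.comp ?_ (ht.comp Primrec.fst))).and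
      ((h0.and (hP₁.comp hm)).or (h0.not.and (hP₂.comp hm)))
    exact Primrec.fst.comp (Primrec.unpair.comp
      (Primrec.snd.comp (Primrec.snd.comp (Primrec.snd.comp Primrec.snd))))
  · simp only [← Config.star_mapInput, Config.forall_mem_star] at h
    have : Nonempty (Fin C.n) := C.connected.nonempty
    have ht := C.eq_of_adj_imp_eq (f := fun v => (l v).unpair.1) fun u v huv =>
      ((h u).1 v huv).symm
    let r : Fin C.n := Classical.arbitrary _
    by_cases h0 : (l r).unpair.1 = 0
    · refine Or.inl ((h₁ C hC).1 (fun v => (l v).unpair.2) fun v => ?_)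
      rcases (h v).2 with h | h
      · exact h.2
      · exact absurd ((ht v r).trans h0) h.1
    · refine Or.inr ((h₂ C hC).1 (fun v => (l v).unpair.2) fun v => ?_)
      rcases (h v).2 with h | h
      · exact absurd ((ht r v).trans h.1) h0
      · exact h.2
  · rintro (q | q)
    · obtain ⟨l, b, a⟩ := (h₁ C hC).2 q
      refine ⟨fun v => Nat.pair 0 (l v), fun v => pair_le_pair (by omega)
        ((b v).trans (by omega)), fun v => ?_⟩
      have e := C.map_star_label (l := fun v => Nat.pair 0 (l v))
        (f := fun p => (p.1, p.2.unpair.2)) (x := fun v => (C.input v, l v)) (by simp) v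
      have t : ∀ u, (Nat.pair 0 (l u)).unpair.1 = 0 := by simp
      exact ⟨(Config.forall_mem_star _ v).2 fun u _ => (t u).trans (t v).symm,
        Or.inl ⟨t v, e ▸ a v⟩⟩
    · obtain ⟨l, b, a⟩ := (h₂ C hC).2 q
      refine ⟨fun v => Nat.pair 1 (l v), fun v => pair_le_pair (by omega)
        ((b v).trans (by omega)), fun v => ?_⟩
      have e := C.map_star_label (l := fun v => Nat.pair 1 (l v))
        (f := fun p => (p.1, p.2.unpair.2)) (x := fun v => (C.input v, l v)) (by simp) v
      have t : ∀ u, (Nat.pair 1 (l u)).unpair.1 = 1 := by simp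
      exact ⟨(Config.forall_mem_star _ v).2 fun u _ => (t u).trans (t v).symm,
        Or.inr ⟨(t v).trans_ne one_ne_zero, e ▸ a v⟩⟩

/-- Certifiability is preserved by existential quantification over labels, provided that these can
be taken polynomially bounded. -/
theorem exists_label [Inhabited J] {Q : Config E (I × J) → Prop} (h : Certifiable N W Q)
    {B : ℕ → ℕ} (hB : PolyBounded B)
    (hb : ∀ C : Config E I, C.Admissible N W → ∀ l : Fin C.n → J, Q (C.label l) →
      ∃ l' : Fin C.n → J, (∀ v, Encodable.encode (l' v) ≤ B C.n) ∧ Q (C.label l')) :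
    Certifiable N W fun C : Config E I => ∃ l : Fin C.n → J, Q (C.label l) := by
  obtain ⟨B', P, hB', hP, h⟩ := h
  -- Codes that decode to nothing are read as `default`, so every numerical labelling stands for
  -- some `J`-labelling and soundness covers all of them.
  have hg : Primrec fun p : I × ℕ =>
      ((p.1, ((Encodable.decode p.2.unpair.1 : Option J).getD default)), p.2.unpair.2) := by
    have hu : Primrec fun p : I × ℕ => p.2.unpair := Primrec.unpair.comp Primrec.snd
    exact Primrec.pair (Primrec.pair Primrec.fst (Primrec.option_getD_default.comp
      (Primrec.decode.comp (Primrec.fst.comp hu)))) (Primrec.snd.comp hu)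
  refine ⟨fun n => Nat.pair (B n) (B' n), fun s => P (s.map fun p =>
      ((p.1, ((Encodable.decode p.2.unpair.1 : Option J).getD default)), p.2.unpair.2)),
    hB.pair hB', hP.comp (Star.primrec_map hg), fun C hC => ⟨fun l hl => ?_, ?_⟩⟩
  · simp only [← Config.star_mapInput] at hl
    exact ⟨fun v => (Encodable.decode (l v).unpair.1 : Option J).getD default,
      (h (C.label _) hC).1 (fun v => (l v).unpair.2) hl⟩
  · rintro ⟨l, hl⟩
    obtain ⟨l, b, hl⟩ := hb C hC l hl
    obtain ⟨l', b', hl'⟩ := (h (C.label l) hC).2 hl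
    refine ⟨fun v => Nat.pair (Encodable.encode (l v)) (l' v),
      fun v => pair_le_pair (b v) (b' v), fun v => ?_⟩
    have e := C.map_star_label (l := fun v => Nat.pair (Encodable.encode (l v)) (l' v))
      (f := fun p => ((p.1, ((Encodable.decode p.2.unpair.1 : Option J).getD default)),
        p.2.unpair.2)) (x := fun v => ((C.input v, l v), l' v)) (by simp) v
    exact (congrArg P e).mpr (hl' v)

end Certifiable

/-! ### Numbers as bit strings of logarithmic length. -/

section Bits

/-- The natural number with the given binary digits, the least significant one first. -/
def natOfBits (l : List Bool) : ℕ := l.foldr Nat.bit 0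

theorem natOfBits_bits (m : ℕ) : natOfBits m.bits = m := by
  induction m using Nat.binaryRec' with
  | zero => rfl
  | bit b n h ih => rw [Nat.bits_append_bit n b h, natOfBits, List.foldr_cons]; congr 1

theorem primrec_natOfBits : Primrec natOfBits := by
  have hp : Primrec fun q : List Bool × (Bool × ℕ) => q.2.2 := Primrec.snd.comp Primrec.snd
  refine (Primrec.list_foldr (h := fun (_ : List Bool) (p : Bool × ℕ) =>
    bif p.1 then 2 * p.2 + 1 else 2 * p.2) Primrec.id (Primrec.const 0) ?_).of_eq fun l => ?_
  · exact Primrec.cond (Primrec.fst.comp Primrec.snd) (Primrec.nat_double_succ.comp hp)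
      (Primrec.nat_double.comp hp)
  · rfl

/-- If m ≤ n ^ a then m has at most a log₂ n + 1 bits, and 1 ≤ log₂ n since n ≥ 2; hence the
constant a + 1. -/
theorem PolyBounded.exists_length_bits_le {B : ℕ → ℕ} (hB : PolyBounded B) :
    ∃ c : ℕ, ∀ n, 2 ≤ n → ∀ m ≤ B n, (m.bits.length : ℝ) ≤ c * Real.logb 2 n := by
  obtain ⟨a, ha⟩ := hB.exists_le_pow
  refine ⟨a + 1, fun n hn m hm => ?_⟩
  have hlog : 1 ≤ Real.logb 2 n := by
    rw [Real.le_logb_iff_rpow_le one_lt_two (by positivity)]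
    simpa using (by exact_mod_cast hn : (2 : ℝ) ≤ n)
  rw [Nat.size_eq_bits_len]
  rcases Nat.eq_zero_or_pos m.size with h0 | h0
  · rw [h0]; push_cast; positivity
  have h1 : 2 ^ (m.size - 1) ≤ n ^ a :=
    (Nat.lt_size.1 (Nat.sub_one_lt_of_lt h0)).trans (hm.trans (ha n hn))
  have h2 : ((m.size - 1 : ℕ) : ℝ) ≤ a * Real.logb 2 n := by
    rw [← Real.logb_pow, Real.le_logb_iff_rpow_le one_lt_two (by positivity), Real.rpow_natCast]
    exact_mod_cast h1
  rw [Nat.cast_sub h0] at h2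
  push_cast at h2 ⊢
  linarith

theorem bits_mem_shortLabellings {c n b : ℕ}
    (h : ∀ m ≤ b, (m.bits.length : ℝ) ≤ c * Real.logb 2 n) {l : Fin n → ℕ}
    (hl : ∀ v, l v ≤ b) : (fun v => (l v).bits) ∈ shortLabellings c n :=
  fun v => h _ (hl v)

theorem nil_mem_shortLabellings (c n : ℕ) : (fun _ => []) ∈ shortLabellings c n := by
  intro v
  have : 0 ≤ Real.logb 2 n :=
    Real.logb_nonneg one_lt_two (by exact_mod_cast Nat.one_le_iff_ne_zero.2 (NeZero.of_pos v.pos).out)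
  simp only [List.length_nil, Nat.cast_zero]
  positivity

end Bits

theorem Config.n_pos (C : Config E I) : 1 ≤ C.n :=
  Fin.pos_iff_nonempty.2 C.connected.nonempty

theorem Config.star_setInput_congr (C : Config E I) {x y : Fin C.n → J} (h : ∀ v, x v = y v)
    (v : Fin C.n) : (C.setInput x).star v = (C.setInput y).star v := by
  rw [funext h]

theorem Config.star_label_congr (C : Config E I) {l l' : Fin C.n → J} (h : ∀ v, l v = l' v)
    (v : Fin C.n) : (C.label l).star v = (C.label l').star v := by
  rw [funext h]

theorem Config.nbrs_eq_nil (C : Config E I) (h : C.n = 1) (v : Fin C.n) : C.nbrs v = [] := by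
  refine List.eq_nil_iff_forall_not_mem.2 fun u hu => ?_
  have : u = v := Fin.ext (by have := u.2; have := v.2; omega)
  exact (((C.mem_nbrs v u).1 hu).ne this.symm).elim

theorem Config.nbrs_ne_nil (C : Config E I) (h : 2 ≤ C.n) (v : Fin C.n) : C.nbrs v ≠ [] := by
  have : Nontrivial (Fin C.n) := Fin.nontrivial_iff_two_le.2 h
  obtain ⟨u, hu⟩ := exists_ne v
  obtain ⟨p, hp, -⟩ := exists_adj_dist_succ C.connected hu.symm
  exact List.ne_nil_of_mem ((C.mem_nbrs v p).2 hp)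

/-! ### From star predicates to computable algorithms on views. -/

section Algorithms

/-- The star of the node with record `c`, computed from the records of its neighbourhood. -/
def starOfRecords (c : NodeRecord E I) (R : List (NodeRecord E I)) :
    Star E (I × List (List Bool)) :=
  ((c.1, c.2.1, c.2.2.1), c.2.2.2.flatMap fun q =>
    (R.filter fun r => decide (r.1 = q.1)).map fun r => (q.2, r.1, r.2.1, r.2.2.1))

/-- Identities are distinct, so looking up a neighbour's identity in the view returns exactly one
record. -/
theorem starOfRecords_view (C : Config E I) (ls : List (Labelling C.n)) (v : Fin C.n) :
    starOfRecords (C.ident v, C.input v, ls.map (fun l => l v),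
        (C.nbrs v).map fun w => (C.ident w, C.edgeData s(v, w))) (C.view ls 1 v).2 =
      (C.label fun u => ls.map fun l => l u).star v := by
  simp only [starOfRecords, Config.star, Config.view, Prod.mk.injEq, true_and]
  rw [List.flatMap_map]
  conv_rhs => rw [List.map_eq_flatMap]
  refine List.flatMap_congr fun u hu => ?_
  have hball : u ∈ C.ball 1 v := List.mem_of_mem_filter hu
  have : ((C.ball 1 v).filter fun w => decide (C.ident w = C.ident u)) = [u] := by
    have h := List.filter_beq (l := C.ball 1 v) u
    rw [List.count_eq_one_of_mem (C.nodup_ball 1 v) hball] at h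
    rw [← List.replicate_one, ← h]
    refine List.filter_congr fun w _ => ?_
    rw [beq_eq_decide]
    simp [C.ident_injective.eq_iff]
  rw [List.filter_map, List.map_map]
  simp only [Function.comp_def]
  rw [this]
  rfl

variable [Primcodable E] [Primcodable I] [Primcodable J] [Primcodable K]

theorem primrec_starOfRecords :
    Primrec fun p : NodeRecord E I × List (NodeRecord E I) => starOfRecords p.1 p.2 := by
  have hc : Primrec fun p : NodeRecord E I × List (NodeRecord E I) => p.1 := Primrec.fst
  refine Primrec.pair (Primrec.pair (Primrec.fst.comp hc)
    (Primrec.pair (Primrec.fst.comp (Primrec.snd.comp hc))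
      (Primrec.fst.comp (Primrec.snd.comp (Primrec.snd.comp hc)))))
    (Primrec.list_flatMap (Primrec.snd.comp (Primrec.snd.comp (Primrec.snd.comp hc)))
      (Primrec.list_map ?_ ?_))
  · exact (PrimrecRel.listFilter (R := fun (r : NodeRecord E I) (i : ℕ) => r.1 = i)
      (Primrec.eq.comp (Primrec.fst.comp Primrec.fst) Primrec.snd)).comp
      (Primrec.snd.comp Primrec.fst) (Primrec.fst.comp Primrec.snd)
  · have hr : Primrec fun p : ((NodeRecord E I × List (NodeRecord E I)) × ℕ × E) ×
        NodeRecord E I => p.2 := Primrec.snd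
    exact Primrec.pair (Primrec.snd.comp (Primrec.snd.comp Primrec.fst))
      (Primrec.pair (Primrec.fst.comp hr) (Primrec.pair (Primrec.fst.comp (Primrec.snd.comp hr))
        (Primrec.fst.comp (Primrec.snd.comp (Primrec.snd.comp hr)))))

theorem exists_algorithm_star {P : Star E (I × List (List Bool)) → Prop} (hP : PrimrecPred P) :
    ∃ A : View E I → Bool, Computable A ∧ ∀ (C : Config E I) (ls : List (Labelling C.n)) v,
      A (C.view ls 1 v) = true ↔ P ((C.label fun u => ls.map fun l => l u).star v) := by
  have h : PrimrecPred fun V : View E I => ∃ c ∈ V.2, c.1 = V.1 ∧ P (starOfRecords c V.2) := by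
    refine primrecPred_exists_mem Primrec.snd ((Primrec.eq.comp (Primrec.fst.comp Primrec.snd)
      (Primrec.fst.comp Primrec.fst)).and (hP.comp (primrec_starOfRecords.comp
        (Primrec.pair Primrec.snd (Primrec.snd.comp Primrec.fst)))))
  obtain ⟨_, h⟩ := h
  refine ⟨_, h.to_comp, fun C ls v => ?_⟩
  rw [decide_eq_true_eq, ← starOfRecords_view]
  constructor
  · rintro ⟨c, hc, hv, h⟩
    obtain ⟨u, hu, rfl⟩ := List.mem_map.1 hc
    obtain rfl : u = v := C.ident_injective hv
    exact h
  · intro h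
    refine ⟨_, List.mem_map.2 ⟨v, ?_, rfl⟩, rfl, h⟩
    simp [C.mem_ball]

/-- In a connected graph a node has no neighbour iff it is alone, so one algorithm can treat n = 1,
where log₂ n = 0 leaves no room for labels, by a separate test on the input. -/
theorem exists_algorithm {g : List (List Bool) → K} (hg : Primrec g) {P : Star E (I × K) → Prop}
    (hP : PrimrecPred P) {P₁ : I → Prop} (hP₁ : PrimrecPred P₁) :
    ∃ A : View E I → Bool, Computable A ∧ ∀ (C : Config E I) (ls : List (Labelling C.n)),
      (C.n = 1 → (C.Accepts 1 A ls ↔ ∀ v, P₁ (C.input v))) ∧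
      (2 ≤ C.n → (C.Accepts 1 A ls ↔
        ∀ v, P ((C.label fun u => g (ls.map fun l => l u)).star v))) := by
  have hm : Primrec fun p : I × List (List Bool) => (p.1, g p.2) :=
    Primrec.pair Primrec.fst (hg.comp Primrec.snd)
  have hnil : PrimrecPred fun s : Star E (I × List (List Bool)) => s.2 = [] :=
    Primrec.eq.comp Primrec.snd (Primrec.const [])
  obtain ⟨A, hA, h⟩ := exists_algorithm_star
    ((hnil.and (hP₁.comp (Primrec.fst.comp (Primrec.snd.comp Primrec.fst)))).or
      (hnil.not.and (hP.comp (Star.primrec_map hm))))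
  refine ⟨A, hA, fun C ls => ⟨fun hn => forall_congr' fun v => ?_,
    fun hn => forall_congr' fun v => ?_⟩⟩
  · rw [h]
    have : ((C.label fun u => ls.map fun l => l u).star v).2 = [] :=
      List.map_eq_nil_iff.2 (C.nbrs_eq_nil hn v)
    simp only [this, true_and, not_true, false_and, or_false]
    rfl
  · rw [h]
    have : ((C.label fun u => ls.map fun l => l u).star v).2 ≠ [] :=
      mt List.map_eq_nil_iff.1 (C.nbrs_ne_nil hn v)
    simp only [this, false_and, not_false_iff, true_and, false_or]
    rw [← Config.star_mapInput]

end Algorithms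

/-! ### Certificates give membership in Σ₁ and Π₂. -/

section Classes

variable [Primcodable E] [Primcodable I] [Primcodable J] {N X W : ℕ → ℕ}

theorem admissible_of_mem {C : Config E I} (hC : C ∈ boundedInstances E I N X W) (hn : 2 ≤ C.n) :
    C.Admissible N W :=
  ⟨hn, fun v => (hC.1 v).2, hC.2.2⟩

theorem mem_sigmaClass_one {L : Language E I} (hL : Certifiable N W (· ∈ L)) {P₁ : I → Prop}
    (hP₁ : PrimrecPred P₁)
    (h₁ : ∀ C ∈ boundedInstances E I N X W, C.n = 1 → (C ∈ L ↔ ∀ v, P₁ (C.input v))) :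
    L ∈ SigmaClass (boundedInstances E I N X W) 1 := by
  obtain ⟨B, P, hB, hP, hL⟩ := hL
  obtain ⟨A, hA, h⟩ := exists_algorithm (g := fun ls => natOfBits ls.headI)
    (primrec_natOfBits.comp Primrec.list_headI) hP hP₁
  obtain ⟨c, hc⟩ := hB.exists_length_bits_le
  refine ⟨c, 1, A, hA, fun C hC => ?_⟩
  simp only [Alternation]
  rcases C.n_pos.eq_or_lt' with hn | hn
  · rw [h₁ C hC hn]
    simp only [(h C _).1 hn]
    exact ⟨fun h => ⟨_, nil_mem_shortLabellings _ _, h⟩, fun ⟨_, _, h⟩ => h⟩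
  · simp only [(h C _).2 hn]
    obtain ⟨s, t⟩ := hL C (admissible_of_mem hC hn)
    refine ⟨fun hCL => ?_, fun ⟨l, _, hl⟩ => s _ hl⟩
    obtain ⟨l, b, hl⟩ := t hCL
    exact ⟨_, bits_mem_shortLabellings (hc C.n hn) b, fun v =>
      (congrArg P (C.star_label_congr (fun v => natOfBits_bits (l v)) v)).mpr (hl v)⟩

/-- `J` is the type of challenges. A short bit string may encode a challenge beyond `B`, so `hL`
covers all challenges; conversely, those within `B` must suffice. The size of the reply depends on n
alone, because `Config.Admissible` ignores inputs and hence the challenge. -/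
theorem mem_piClass_two [Inhabited J] {L : Language E I} {Q : Config E (I × J) → Prop}
    (hQ : Certifiable N W Q) {B : ℕ → ℕ} (hB : PolyBounded B)
    (hL : ∀ C : Config E I, C.Admissible N W → C ∈ L → ∀ l : Fin C.n → J, Q (C.label l))
    (hb : ∀ C : Config E I, C.Admissible N W → (∀ l : Fin C.n → J,
      (∀ v, Encodable.encode (l v) ≤ B C.n) → Q (C.label l)) → C ∈ L)
    {P₁ : I → Prop} (hP₁ : PrimrecPred P₁)
    (h₁ : ∀ C ∈ boundedInstances E I N X W, C.n = 1 → (C ∈ L ↔ ∀ v, P₁ (C.input v))) :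
    L ∈ PiClass (boundedInstances E I N X W) 2 := by
  obtain ⟨B', P, hB', hP, hQ⟩ := hQ
  have hm : Primrec fun p : I × J × ℕ => ((p.1, p.2.1), p.2.2) :=
    Primrec.pair (Primrec.pair Primrec.fst (Primrec.fst.comp Primrec.snd))
      (Primrec.snd.comp Primrec.snd)
  obtain ⟨A, hA, h⟩ := exists_algorithm
    (g := fun ls => (((Encodable.decode (natOfBits ls.headI) : Option J).getD default),
      natOfBits ls.tail.headI))
    (Primrec.pair (Primrec.option_getD_default.comp (Primrec.decode.comp
      (primrec_natOfBits.comp Primrec.list_headI)))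
      (primrec_natOfBits.comp (Primrec.list_headI.comp Primrec.list_tail)))
    (hP.comp (Star.primrec_map hm)) hP₁
  -- One constant has to serve both the challenge and the reply.
  obtain ⟨c, hc⟩ := (hB.add hB').exists_length_bits_le
  refine ⟨c, 1, A, hA, fun C hC => ?_⟩
  simp only [Alternation]
  rcases C.n_pos.eq_or_lt' with hn | hn
  · rw [h₁ C hC hn]
    simp only [(h C _).1 hn]
    exact ⟨fun h l hl => ⟨l, hl, h⟩,
      fun h => (h _ (nil_mem_shortLabellings _ _)).choose_spec.2⟩
  · have hC' := admissible_of_mem hC hn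
    simp only [(h C _).2 hn, ← Config.star_mapInput]
    refine ⟨fun hCL l hl => ?_, fun hl => hb C hC' fun l b => ?_⟩
    · have q := hL C hC' hCL fun v =>
        ((Encodable.decode (natOfBits (l v)) : Option J).getD default)
      obtain ⟨l', b', hl'⟩ := (hQ (C.label _) hC').2 q
      exact ⟨_, bits_mem_shortLabellings (hc C.n hn)
        fun v => (b' v).trans (Nat.le_add_left _ _), fun v => (congrArg P
        (Config.star_label_congr _ (fun v => natOfBits_bits (l' v)) v)).mpr (hl' v)⟩
    · obtain ⟨l', -, hl'⟩ := hl _ (bits_mem_shortLabellings (hc C.n hn)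
        fun v => (b v).trans (Nat.le_add_right _ _))
      have e : ∀ v, ((Encodable.decode (natOfBits (Encodable.encode (l v)).bits) :
          Option J).getD default) = l v := by
        simp [natOfBits_bits]
      refine (hQ (C.label l) hC').1 (fun v => natOfBits (l' v)) fun v => ?_
      refine (congrArg P ?_).mpr (hl' v)
      exact C.star_setInput_congr (x := fun v => ((C.input v, l v), natOfBits (l' v)))
        (fun v => congrArg (fun j => ((C.input v, j), natOfBits (l' v))) (e v).symm) v

end Classes

/-! ### Rooted trees given by parent pointers and depths. -/

section ParentTree

variable {V : Type*} {r : V} {par : V → V} {d : V → ℕ}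

/-- The graph joining every node `v ≠ r` to its parent. -/
def parentGraph (r : V) (par : V → V) : SimpleGraph V :=
  SimpleGraph.fromRel fun v p => v ≠ r ∧ p = par v

theorem parentGraph_adj (hd : ∀ v, v ≠ r → d v = d (par v) + 1) {v : V} (hv : v ≠ r) :
    (parentGraph r par).Adj v (par v) := by
  rw [parentGraph, SimpleGraph.fromRel_adj]
  refine ⟨fun h => ?_, Or.inl ⟨hv, rfl⟩⟩
  have := hd v hv
  rw [← h] at this
  omega

theorem parentGraph_connected (hd : ∀ v, v ≠ r → d v = d (par v) + 1) :
    (parentGraph r par).Connected := by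
  have key : ∀ k v, d v = k → (parentGraph r par).Reachable v r := by
    intro k
    induction k with
    | zero =>
      intro v hk
      by_cases hv : v = r
      · rw [hv]
      · have := hd v hv
        omega
    | succ k ih =>
      intro v hk
      by_cases hv : v = r
      · rw [hv]
      · exact (parentGraph_adj hd hv).reachable.trans (ih _ (by have := hd v hv; omega))
  have : Nonempty V := ⟨r⟩
  exact ⟨fun u v => (key _ u rfl).trans (key _ v rfl).symm⟩

/-- The graph is connected, and every edge has the form `s(v, par v)` with `v ≠ r`, so there are at
most n - 1 of them. -/
theorem parentGraph_isTree [Fintype V] (hd : ∀ v, v ≠ r → d v = d (par v) + 1) :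
    (parentGraph r par).IsTree := by
  classical
  have hc := parentGraph_connected hd
  rw [SimpleGraph.isTree_iff_connected_and_card]
  refine ⟨hc, le_antisymm ?_ hc.card_vert_le_card_edgeSet_add_one⟩
  have hsub : (parentGraph r par).edgeSet ⊆
      ((Finset.univ.erase r).image fun v => s(v, par v) : Finset (Sym2 V)) := by
    intro e
    induction e with
    | h a b =>
      rw [SimpleGraph.mem_edgeSet, parentGraph, SimpleGraph.fromRel_adj]
      rintro ⟨-, ⟨h, rfl⟩ | ⟨h, rfl⟩⟩
      · exact Finset.mem_coe.2 (Finset.mem_image.2 ⟨a, by simpa using h, rfl⟩)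
      · exact Finset.mem_coe.2 (Finset.mem_image.2 ⟨b, by simpa using h, Sym2.eq_swap⟩)
  have h1 := Set.ncard_le_ncard hsub (Finset.finite_toSet _)
  rw [Set.ncard_coe_finset] at h1
  have h2 := h1.trans Finset.card_image_le
  rw [Finset.card_erase_of_mem (Finset.mem_univ r), Finset.card_univ] at h2
  have h3 : 0 < Fintype.card V := Fintype.card_pos_iff.2 ⟨r⟩
  rw [Nat.card_eq_fintype_card (α := V), Nat.card_coe_set_eq]
  omega

/-- Following parents gives a walk of length `d v`; no walk is shorter, as `d` changes by exactly
one along each edge. -/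
theorem parentGraph_dist (h0 : d r = 0) (hd : ∀ v, v ≠ r → d v = d (par v) + 1) (v : V) :
    (parentGraph r par).dist v r = d v := by
  have hc := parentGraph_connected hd
  apply le_antisymm
  · have key : ∀ k v, d v = k → (parentGraph r par).dist v r ≤ k := by
      intro k
      induction k with
      | zero =>
        intro v hk
        by_cases hv : v = r
        · simp [hv]
        · have := hd v hv
          omega
      | succ k ih =>
        intro v hk
        by_cases hv : v = r
        · simp [hv]
        · have h1 := hc.dist_triangle (u := v) (v := par v) (w := r)
          rw [SimpleGraph.dist_eq_one_iff_adj.2 (parentGraph_adj hd hv)] at h1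
          have := ih (par v) (by have := hd v hv; omega)
          omega
    exact key _ v rfl
  · have key : ∀ u w, ∀ p : (parentGraph r par).Walk u w, d u ≤ d w + p.length := by
      intro u w p
      induction p with
      | nil => simp
      | @cons a b c hab p ih =>
        rw [SimpleGraph.Walk.length_cons]
        rw [parentGraph, SimpleGraph.fromRel_adj] at hab
        rcases hab with ⟨-, ⟨h, rfl⟩ | ⟨h, rfl⟩⟩
        · have := hd _ h
          omega
        · have := hd _ h
          omega
    obtain ⟨p, hp⟩ := hc.exists_walk_length_eq_dist v r
    have := key v r p
    omega

end ParentTree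

/-- The input gives parents `par v` of all nodes `v` other than the root `r`, and `d` is the
depth. -/
structure Config.IsRooting (C : Config E (Option ℕ)) (r : Fin C.n) (par : Fin C.n → Fin C.n)
    (d : Fin C.n → ℕ) : Prop where
  input_root : C.input r = none
  depth_root : d r = 0
  adj : ∀ v, v ≠ r → C.graph.Adj v (par v)
  depth : ∀ v, v ≠ r → d v = d (par v) + 1
  input : ∀ v, v ≠ r → C.input v = some (C.ident (par v))

theorem Config.EncodesTree.exists_isRooting {C : Config E (Option ℕ)}
    {T : SimpleGraph (Fin C.n)} (hT : C.IsSpanningTree T) (h : C.EncodesTree T) :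
    ∃ r par, C.IsRooting r par (fun v => T.dist v r) ∧ ∀ v, v ≠ r → T.Adj v (par v) := by
  obtain ⟨r, hr, h⟩ := h
  have : ∀ v, ∃ p, v ≠ r →
      T.Adj v p ∧ T.dist v r = T.dist p r + 1 ∧ C.input v = some (C.ident p) := by
    intro v
    by_cases hv : v = r
    · exact ⟨v, fun h => absurd hv h⟩
    · obtain ⟨p, hp⟩ := h v hv
      exact ⟨p, fun _ => hp⟩
  choose par hpar using this
  exact ⟨r, par, ⟨hr, SimpleGraph.dist_self, fun v hv => hT.1 (hpar v hv).1,
    fun v hv => (hpar v hv).2.1, fun v hv => (hpar v hv).2.2⟩, fun v hv => (hpar v hv).1⟩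

theorem Config.IsRooting.mem_spanningTree {C : Config E (Option ℕ)} {r : Fin C.n}
    {par : Fin C.n → Fin C.n} {d : Fin C.n → ℕ} (h : C.IsRooting r par d) :
    C ∈ spanningTree E := by
  refine ⟨parentGraph r par, ⟨?_, parentGraph_isTree h.depth⟩, r, h.input_root, fun v hv =>
    ⟨par v, parentGraph_adj h.depth hv, ?_, h.input v hv⟩⟩
  · intro a b hab
    rw [parentGraph, SimpleGraph.fromRel_adj] at hab
    rcases hab with ⟨-, ⟨h', rfl⟩ | ⟨h', rfl⟩⟩
    · exact h.adj _ h'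
    · exact (h.adj _ h').symm
  · rw [parentGraph_dist h.depth_root h.depth, parentGraph_dist h.depth_root h.depth,
      h.depth v hv]

theorem exists_isRooting {C : Config E (Option ℕ)} (h : C ∈ spanningTree E) :
    ∃ r par d, C.IsRooting r par d ∧ ∀ v, d v < C.n := by
  obtain ⟨T, hT, hE⟩ := h
  obtain ⟨r, par, h, -⟩ := hE.exists_isRooting hT
  exact ⟨r, par, _, h, fun v => by simpa using dist_lt_card hT.2.1 v r⟩

theorem exists_encodesTree (C : Config E I) {T : SimpleGraph (Fin C.n)}
    (hT : T.Connected) : ∃ x : Fin C.n → Option ℕ, (C.setInput x).EncodesTree T := by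
  obtain ⟨r⟩ := hT.nonempty
  have : ∀ v, ∃ y : Option ℕ, (v = r → y = none) ∧
      (v ≠ r → ∃ p, T.Adj v p ∧ T.dist v r = T.dist p r + 1 ∧ y = some (C.ident p)) := by
    intro v
    by_cases hv : v = r
    · exact ⟨none, fun _ => rfl, fun h => absurd hv h⟩
    · obtain ⟨p, hp, hd⟩ := exists_adj_dist_succ hT hv
      exact ⟨some (C.ident p), fun h => absurd h hv, fun _ => ⟨p, hp, hd, rfl⟩⟩
  choose x h0 h1 using this
  exact ⟨x, r, h0 r rfl, h1⟩

theorem exists_mem_spanningTree (C : Config E I) :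
    ∃ x : Fin C.n → Option ℕ, C.setInput x ∈ spanningTree E := by
  obtain ⟨T, hle, hT⟩ := C.connected.exists_isTree_le
  obtain ⟨x, hx⟩ := exists_encodesTree C hT.1
  exact ⟨x, T, ⟨hle, hT⟩, hx⟩

/-- The disjuncts are a bad pointer, two roots told apart by a colouring, and a nonempty rootless
set closed under pointers, which also covers the absence of any root. If all fail, every pointer
chain ends at the one root, and its length is a depth. -/
theorem not_mem_spanningTree_iff (C : Config E (Option ℕ)) :
    C ∉ spanningTree E ↔
      (∃ v, C.input v ≠ none ∧ ∀ u, C.graph.Adj v u → C.input v ≠ some (C.ident u)) ∨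
      (∃ l : Fin C.n → Bool, (∃ v, C.input v = none ∧ l v = true) ∧
        ∃ v, C.input v = none ∧ l v = false) ∨
      ∃ l : Fin C.n → Bool, (∃ v, l v = true) ∧
        ∀ v, l v = true → ∃ u, C.graph.Adj v u ∧ C.input v = some (C.ident u) ∧ l u = true := by
  constructor
  · intro h
    by_contra! hcon
    obtain ⟨h1, h2, h3⟩ := hcon
    refine h ?_
    have : ∀ v, ∃ u, C.input v ≠ none → C.graph.Adj v u ∧ C.input v = some (C.ident u) := by
      intro v
      by_cases hv : C.input v = none
      · exact ⟨v, fun h => absurd hv h⟩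
      · obtain ⟨u, hu⟩ := h1 v hv
        exact ⟨u, fun _ => hu⟩
    choose par hpar using this
    have hreach : ∀ v, ∃ k, C.input (par^[k] v) = none := by
      classical
      by_contra! hcon
      obtain ⟨v, hv⟩ := hcon
      -- The nodes whose chain never meets a root form a set closed under pointers.
      obtain ⟨u, hu, hu'⟩ := h3 (fun v => decide (∀ k, C.input (par^[k] v) ≠ none))
        ⟨v, by simpa using hv⟩
      rw [decide_eq_true_eq] at hu
      obtain ⟨ha, hi⟩ := hpar u (hu 0)
      have h' := hu' (par u) ha hi
      simp only [ne_eq, decide_eq_true_eq] at h'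
      exact h' fun k => hu (k + 1)
    classical
    obtain ⟨v0⟩ := C.connected.nonempty
    obtain ⟨k0, hr⟩ := hreach v0
    set r := par^[k0] v0
    have hne : ∀ v, v ≠ r → C.input v ≠ none := by
      intro v hv hn
      have := h2 (fun v => decide (v = r)) ⟨r, hr, by simp⟩ v hn
      simp [hv] at this
    refine Config.IsRooting.mem_spanningTree (r := r) (par := par)
      (d := fun v => Nat.find (hreach v)) ⟨hr, ?_, fun v hv => (hpar v (hne v hv)).1,
        fun v hv => ?_, fun v hv => (hpar v (hne v hv)).2⟩
    · exact (Nat.find_eq_zero _).2 hr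
    · exact Nat.find_comp_succ (hreach v) (hreach (par v)) (hne v hv)
  · intro h hC
    obtain ⟨r, par, d, hR, -⟩ := exists_isRooting hC
    have hr : ∀ v, C.input v = none → v = r := by
      intro v hv
      by_contra hne
      rw [hR.input v hne] at hv
      cases hv
    rcases h with ⟨v, hv, h⟩ | ⟨l, ⟨v, hv, hlv⟩, u, hu, hlu⟩ | ⟨l, ⟨v, hv⟩, h⟩
    · have hne : v ≠ r := by
        rintro rfl
        exact hv hR.input_root
      exact h _ (hR.adj v hne) (hR.input v hne)
    · rw [hr v hv] at hlv
      rw [hr u hu, hlv] at hlu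
      cases hlu
    -- Infinite descent: pointers stay in the set while the depth drops.
    · have key : ∀ k v, d v = k → l v = true → False := by
        intro k
        induction k with
        | zero =>
          intro v hk hv
          obtain ⟨u, -, hu, -⟩ := h v hv
          by_cases hne : v = r
          · rw [hne, hR.input_root] at hu
            cases hu
          · have := hR.depth v hne
            omega
        | succ k ih =>
          intro v hk hv
          obtain ⟨u, -, hu, hlu⟩ := h v hv
          by_cases hne : v = r
          · rw [hne, hR.input_root] at hu
            cases hu
          · rw [hR.input v hne, Option.some_inj] at hu
            rw [← C.ident_injective hu] at hlu
            exact ih _ (by have := hR.depth v hne; omega) hlu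
      exact key _ v rfl hv

/-! ### Certificates for spanning trees and for non-trees. -/

section Certificates

variable [Primcodable E] {N W : ℕ → ℕ}

/-- The label is the depth and the identity of the root. Descending depths exclude pointer cycles;
the common identity excludes a second root. -/
theorem certifiable_spanningTree (hN : PolyBounded N) :
    Certifiable N W (· ∈ spanningTree E) := by
  let P : Star E (Option ℕ × ℕ × ℕ) → Prop := fun s =>
    (∀ q ∈ s.2, q.2.2.2.2 = s.1.2.2.2) ∧
      ((s.1.2.1 = none ∧ s.1.1 = s.1.2.2.2 ∧ s.1.2.2.1 = 0) ∨
        ∃ q ∈ s.2, s.1.2.1 = some q.2.1 ∧ s.1.2.2.1 = q.2.2.2.1 + 1)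
  have hP : PrimrecPred P := by
    have hi : Primrec fun s : Star E (Option ℕ × ℕ × ℕ) => s.1.2.1 :=
      Primrec.fst.comp (Primrec.snd.comp Primrec.fst)
    have hl : Primrec fun s : Star E (Option ℕ × ℕ × ℕ) => s.1.2.2 :=
      Primrec.snd.comp (Primrec.snd.comp Primrec.fst)
    have hd := Primrec.fst.comp hl
    have hr := Primrec.snd.comp hl
    have hl' : Primrec fun p : Star E (Option ℕ × ℕ × ℕ) × (E × ℕ × Option ℕ × ℕ × ℕ) =>
        p.2.2.2.2 := Primrec.snd.comp (Primrec.snd.comp (Primrec.snd.comp Primrec.snd))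
    refine (primrecPred_forall_mem Primrec.snd (Primrec.eq.comp (Primrec.snd.comp hl')
      (hr.comp Primrec.fst))).and (((Primrec.eq.comp hi (Primrec.const none)).and
      ((Primrec.eq.comp (Primrec.fst.comp Primrec.fst) hr).and
        (Primrec.eq.comp hd (Primrec.const 0)))).or (primrecPred_exists_mem Primrec.snd
      ((Primrec.eq.comp (hi.comp Primrec.fst) (Primrec.option_some.comp
        (Primrec.fst.comp (Primrec.snd.comp Primrec.snd)))).and
        (Primrec.eq.comp (hd.comp Primrec.fst) (Primrec.succ.comp (Primrec.fst.comp hl'))))))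
  have key : ∀ (C : Config E (Option ℕ)) (l : Fin C.n → ℕ × ℕ),
      (∀ v, P ((C.label l).star v)) ↔ ∀ v, (∀ u, C.graph.Adj v u → (l u).2 = (l v).2) ∧
        ((C.input v = none ∧ C.ident v = (l v).2 ∧ (l v).1 = 0) ∨
          ∃ u, C.graph.Adj v u ∧ C.input v = some (C.ident u) ∧ (l v).1 = (l u).1 + 1) :=
    fun C l => forall_congr' fun v => and_congr (Config.forall_mem_star (C.label l) v)
      (or_congr Iff.rfl (Config.exists_mem_star (C.label l) v))
  have hcompl : ∀ C : Config E (Option ℕ), C.Admissible N W → C ∈ spanningTree E →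
      ∃ l : Fin C.n → ℕ × ℕ, (∀ v, Encodable.encode (l v) ≤ Nat.pair C.n (N C.n)) ∧
        ∀ v, P ((C.label l).star v) := by
    intro C hC h
    obtain ⟨r, par, d, h, hlt⟩ := exists_isRooting h
    refine ⟨fun v => (d v, C.ident r), fun v => pair_le_pair (hlt v).le (hC.2.1 r),
      (key C _).2 fun v => ⟨fun _ _ => rfl, ?_⟩⟩
    by_cases hv : v = r
    · rw [hv]
      exact Or.inl ⟨h.input_root, rfl, h.depth_root⟩
    · exact Or.inr ⟨par v, h.adj v hv, h.input v hv, h.depth v hv⟩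
  have hsound : ∀ (C : Config E (Option ℕ)) (l : Fin C.n → ℕ × ℕ),
      (∀ v, P ((C.label l).star v)) → C ∈ spanningTree E := by
    intro C l h
    rw [key] at h
    have : Nonempty (Fin C.n) := C.connected.nonempty
    -- A node of minimal claimed depth cannot have a parent of smaller depth, so it is a root.
    obtain ⟨r, -, hr⟩ := Finset.exists_min_image Finset.univ (fun v => (l v).1)
      Finset.univ_nonempty
    have hroot : C.input r = none ∧ C.ident r = (l r).2 ∧ (l r).1 = 0 := by
      rcases (h r).2 with h | ⟨u, -, -, hu⟩
      · exact h
      · have := hr u (Finset.mem_univ _)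
        omega
    have hR := C.eq_of_adj_imp_eq (f := fun v => (l v).2) fun u v huv => ((h u).1 v huv).symm
    have : ∀ v, ∃ u, v ≠ r →
        C.graph.Adj v u ∧ C.input v = some (C.ident u) ∧ (l v).1 = (l u).1 + 1 := by
      intro v
      rcases (h v).2 with h' | ⟨u, hu⟩
      · refine ⟨v, fun hv => absurd (C.ident_injective ?_) hv⟩
        rw [h'.2.1, hroot.2.1]
        exact hR v r
      · exact ⟨u, fun _ => hu⟩
    choose par hpar using this
    exact Config.IsRooting.mem_spanningTree (r := r) (par := par) (d := fun v => (l v).1)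
      ⟨hroot.1, hroot.2.2, fun v hv => (hpar v hv).1, fun v hv => (hpar v hv).2.2,
        fun v hv => (hpar v hv).2.1⟩
  refine ((Certifiable.forall_node hP).exists_label (PolyBounded.id.pair hN)
    fun C hC l hl => hcompl C hC (hsound C l hl)).congr fun C hC =>
      ⟨fun ⟨l, hl⟩ => hsound C l hl, fun h => ?_⟩
  obtain ⟨l, -, hl⟩ := hcompl C hC h
  exact ⟨l, hl⟩

theorem Certifiable.exists_bool [Primcodable I] {Q : Config E (I × Bool) → Prop}
    (h : Certifiable N W Q) :
    Certifiable N W fun C : Config E I => ∃ l : Fin C.n → Bool, Q (C.label l) :=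
  h.exists_label (.const 1) fun _ _ l hl => ⟨l, fun v => by cases l v <;> decide, hl⟩

theorem certifiable_not_spanningTree : Certifiable N W (· ∉ spanningTree E) := by
  have hi : Primrec fun s : Star E (Option ℕ) => s.1.2 := Primrec.snd.comp Primrec.fst
  have hi' : Primrec fun s : Star E (Option ℕ × Bool) => s.1.2.1 :=
    Primrec.fst.comp (Primrec.snd.comp Primrec.fst)
  have hl : Primrec fun s : Star E (Option ℕ × Bool) => s.1.2.2 :=
    Primrec.snd.comp (Primrec.snd.comp Primrec.fst)
  have h1 := Certifiable.exists_node (N := N) (W := W)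
    (P := fun s : Star E (Option ℕ) => s.1.2 ≠ none ∧ ∀ q ∈ s.2, s.1.2 ≠ some q.2.1)
    ((Primrec.eq.comp hi (Primrec.const none)).not.and (primrecPred_forall_mem Primrec.snd
      (Primrec.eq.comp (hi.comp Primrec.fst) (Primrec.option_some.comp
        (Primrec.fst.comp (Primrec.snd.comp Primrec.snd)))).not))
  have h2 := fun b => Certifiable.exists_node (N := N) (W := W)
    (P := fun s : Star E (Option ℕ × Bool) => s.1.2.1 = none ∧ s.1.2.2 = b)
    ((Primrec.eq.comp hi' (Primrec.const none)).and (Primrec.eq.comp hl (Primrec.const b)))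
  have h3 := Certifiable.exists_node (N := N) (W := W)
    (P := fun s : Star E (Option ℕ × Bool) => s.1.2.2 = true)
    (Primrec.eq.comp hl (Primrec.const true))
  have h4 := Certifiable.forall_node (N := N) (W := W)
    (P := fun s : Star E (Option ℕ × Bool) => s.1.2.2 = true →
      ∃ q ∈ s.2, s.1.2.1 = some q.2.1 ∧ q.2.2.2 = true)
    (primrecPred_imp (Primrec.eq.comp hl (Primrec.const true))
      (primrecPred_exists_mem Primrec.snd ((Primrec.eq.comp (hi'.comp Primrec.fst)
        (Primrec.option_some.comp (Primrec.fst.comp (Primrec.snd.comp Primrec.snd)))).and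
        (Primrec.eq.comp (Primrec.snd.comp (Primrec.snd.comp (Primrec.snd.comp Primrec.snd)))
          (Primrec.const true)))))
  refine (h1.or (((h2 true).and (h2 false)).exists_bool.or (h3.and h4).exists_bool)).congr
    fun C _ => ?_
  rw [not_mem_spanningTree_iff]
  refine or_congr (exists_congr fun v => and_congr Iff.rfl (Config.forall_mem_star C v))
    (or_congr Iff.rfl (exists_congr fun l => and_congr Iff.rfl (forall_congr' fun v =>
      imp_congr Iff.rfl (Config.exists_mem_star (C.label l) v))))

end Certificates

/-! ### Sums over subtrees of a rooted tree. -/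

section SubtreeSums

variable {V : Type*} [Fintype V] [DecidableEq V] {r : V} {par : V → V} {d : V → ℕ} {φ S : V → ℕ}

/-- Iterate the recursion from zero. The value at `v` is stable after m rounds once `d v + m`
exceeds every depth; the sum of all depths is a crude bound for these. -/
theorem exists_subtreeSums (hd : ∀ v, v ≠ r → d v = d (par v) + 1) (φ : V → ℕ) :
    ∃ S : V → ℕ, ∀ v, S v = φ v + ∑ u, if u ≠ r ∧ par u = v then S u else 0 := by
  let T : ℕ → V → ℕ := fun m => Nat.rec (fun _ => 0)
    (fun _ t v => φ v + ∑ u, if u ≠ r ∧ par u = v then t u else 0) m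
  have hT : ∀ m v, T (m + 1) v = φ v + ∑ u, if u ≠ r ∧ par u = v then T m u else 0 :=
    fun _ _ => rfl
  have key : ∀ m v, ∑ u, d u < d v + m → T (m + 1) v = T m v := by
    intro m
    induction m with
    | zero =>
      intro v hv
      have := Finset.single_le_sum (f := d) (fun _ _ => Nat.zero_le _) (Finset.mem_univ v)
      omega
    | succ m ih =>
      intro v hv
      rw [hT (m + 1), hT m]
      congr 1
      refine Finset.sum_congr rfl fun u _ => ?_
      split_ifs with hu
      · obtain ⟨h, rfl⟩ := hu
        exact ih u (by have := hd u h; omega)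
      · rfl
  refine ⟨T (∑ u, d u + 1), fun v => ?_⟩
  exact (key (∑ u, d u + 1) v (by omega)).symm.trans (hT (∑ u, d u + 1) v)

/-- Add the equations over all `v`: every `S u` with `u ≠ r` occurs once on each side, and cancels.
-/
theorem subtreeSums_root (hS : ∀ v, S v = φ v + ∑ u, if u ≠ r ∧ par u = v then S u else 0) :
    S r = ∑ v, φ v := by
  have h1 : ∑ v, S v = ∑ v, φ v + ∑ u, if u ≠ r then S u else 0 := by
    rw [Finset.sum_congr rfl fun v _ => hS v, Finset.sum_add_distrib, Finset.sum_comm]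
    congr 1
    refine Finset.sum_congr rfl fun u _ => ?_
    by_cases hu : u = r <;> simp [hu]
  have h2 : ∑ v, S v = S r + ∑ u, if u ≠ r then S u else 0 := by
    rw [← Finset.add_sum_erase _ _ (Finset.mem_univ r), ← Finset.sum_filter]
    congr 2
    ext u
    simp
  omega

/-- Partial sums increase towards the root. This keeps the labels polynomial. -/
theorem subtreeSums_le (hd : ∀ v, v ≠ r → d v = d (par v) + 1)
    (hS : ∀ v, S v = φ v + ∑ u, if u ≠ r ∧ par u = v then S u else 0) (v : V) :
    S v ≤ ∑ v, φ v := by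
  rw [← subtreeSums_root hS]
  have key : ∀ k v, d v = k → S v ≤ S r := by
    intro k
    induction k with
    | zero =>
      intro v hk
      by_cases hv : v = r
      · rw [hv]
      · have := hd v hv
        omega
    | succ k ih =>
      intro v hk
      by_cases hv : v = r
      · rw [hv]
      · refine le_trans ?_ (ih (par v) (by have := hd v hv; omega))
        rw [hS (par v)]
        have := Finset.single_le_sum (f := fun u => if u ≠ r ∧ par u = par v then S u else 0)
          (fun _ _ => Nat.zero_le _) (Finset.mem_univ v)
        rw [if_pos ⟨hv, rfl⟩] at this
        exact this.trans (Nat.le_add_left _ _)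
  exact key _ v rfl

end SubtreeSums

open Classical in
-- A node recognizes its children locally, as the neighbours that point to its identity.
theorem Config.IsRooting.sum_children {C : Config E I} {y : Fin C.n → Option ℕ} {r : Fin C.n}
    {par : Fin C.n → Fin C.n} {d : Fin C.n → ℕ} (h : (C.setInput y).IsRooting r par d)
    (S : Fin C.n → ℕ) (v : Fin C.n) :
    (∑ u, if C.graph.Adj v u then (if y u = some (C.ident v) then S u else 0) else 0) =
      ∑ u, if u ≠ r ∧ par u = v then S u else 0 := by
  refine Finset.sum_congr rfl fun u _ => ?_
  by_cases hu : u = r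
  · have : y u = none := hu ▸ h.input_root
    simp [hu, hu ▸ this]
  · have hy : y u = some (C.ident (par u)) := h.input u hu
    by_cases hp : par u = v
    · have : C.graph.Adj v u := hp ▸ (h.adj u hu).symm
      simp [hu, hp, this, hp ▸ hy]
    · simp [hp, hy, C.ident_injective.eq_iff]

/-! ### Comparing two global sums. -/

section Sums

variable [Primcodable E] [Primcodable I] {N W : ℕ → ℕ}

/-- The guessed labels are a parent pointer and the two subtree sums. Each node checks the
recursion, and the root, which holds both totals, checks `R`. -/
theorem certifiable_sum_rel (hN : PolyBounded N) {f g : Star E I → ℕ} (hf : Primrec f)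
    (hg : Primrec g) {B : ℕ → ℕ} (hB : PolyBounded B)
    (hfB : ∀ C : Config E I, C.Admissible N W → ∀ v, f (C.star v) ≤ B C.n)
    (hgB : ∀ C : Config E I, C.Admissible N W → ∀ v, g (C.star v) ≤ B C.n)
    {R : ℕ → ℕ → Prop} (hR : PrimrecRel R) :
    Certifiable N W fun C : Config E I => R (∑ v, f (C.star v)) (∑ v, g (C.star v)) := by
  classical
  let J := Option ℕ × ℕ × ℕ
  let kids : (J → ℕ) → Star E (I × J) → ℕ := fun a s =>
    (s.2.map fun q => if q.2.2.2.1 = some s.1.1 then a q.2.2.2 else 0).sum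
  let P : Star E (I × J) → Prop := fun s =>
    s.1.2.2.2.1 = f (s.map Prod.fst) + kids (fun j => j.2.1) s ∧
    s.1.2.2.2.2 = g (s.map Prod.fst) + kids (fun j => j.2.2) s ∧
    (s.1.2.2.1 = none → R s.1.2.2.2.1 s.1.2.2.2.2)
  have hkids : ∀ a : J → ℕ, Primrec a → Primrec (kids a) := by
    intro a ha
    have hl : Primrec fun p : Star E (I × J) × (E × ℕ × I × J) => p.2.2.2.2 :=
      Primrec.snd.comp (Primrec.snd.comp (Primrec.snd.comp Primrec.snd))
    exact primrec_sum_map Primrec.snd (Primrec.ite (Primrec.eq.comp (Primrec.fst.comp hl)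
      (Primrec.option_some.comp (Primrec.fst.comp (Primrec.fst.comp Primrec.fst))))
      (ha.comp hl) (Primrec.const 0))
  have hP : PrimrecPred P := by
    have hl : Primrec fun s : Star E (I × J) => s.1.2.2 :=
      Primrec.snd.comp (Primrec.snd.comp Primrec.fst)
    have h1 := Primrec.fst.comp (Primrec.snd.comp hl)
    have h2 := Primrec.snd.comp (Primrec.snd.comp hl)
    have hm := Star.primrec_map (E := E) (Primrec.fst (α := I) (β := J))
    exact (Primrec.eq.comp h1 (Primrec.nat_add.comp (hf.comp hm)
      (hkids _ (Primrec.fst.comp Primrec.snd)))).and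
      ((Primrec.eq.comp h2 (Primrec.nat_add.comp (hg.comp hm)
      (hkids _ (Primrec.snd.comp Primrec.snd)))).and
      (primrecPred_imp (Primrec.eq.comp (Primrec.fst.comp hl) (Primrec.const none))
        (hR.comp h1 h2)))
  have hstar : ∀ (C : Config E I) (l : Fin C.n → J) v,
      ((C.label l).star v).map Prod.fst = C.star v :=
    fun C l v => C.map_star_label (x := C.input) (fun _ => rfl) v
  have hk : ∀ (C : Config E I) (l : Fin C.n → J) (a : J → ℕ) v, kids a ((C.label l).star v) =
      ∑ u, if C.graph.Adj v u then (if (l u).1 = some (C.ident v) then a (l u) else 0) else 0 :=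
    fun C l a v => Config.sum_star (C.label l) v _
  have key : ∀ (C : Config E I) (l : Fin C.n → J) r par d,
      (C.setInput fun v => (l v).1).IsRooting r par d →
      ((∀ v, P ((C.label l).star v)) ↔
        (∀ v, (l v).2.1 = f (C.star v) + ∑ u, if u ≠ r ∧ par u = v then (l u).2.1 else 0) ∧
        (∀ v, (l v).2.2 = g (C.star v) + ∑ u, if u ≠ r ∧ par u = v then (l u).2.2 else 0) ∧
        R (l r).2.1 (l r).2.2) := by
    intro C l r par d h
    have e : ∀ v, P ((C.label l).star v) ↔
        ((l v).2.1 = f (C.star v) + ∑ u, if u ≠ r ∧ par u = v then (l u).2.1 else 0) ∧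
        ((l v).2.2 = g (C.star v) + ∑ u, if u ≠ r ∧ par u = v then (l u).2.2 else 0) ∧
        ((l v).1 = none → R (l v).2.1 (l v).2.2) := by
      intro v
      simp only [P, hstar, hk]
      rw [h.sum_children fun u => (l u).2.1, h.sum_children fun u => (l u).2.2]
      rfl
    simp only [e, forall_and]
    refine and_congr Iff.rfl (and_congr Iff.rfl ⟨fun h' => h' r h.input_root, fun h' v hv => ?_⟩)
    by_cases hne : v = r
    · rwa [hne]
    · exact absurd ((h.input v hne).symm.trans hv) (by simp)
  have hsound : ∀ (C : Config E I) (l : Fin C.n → J),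
      ((C.label l).mapInput fun p => p.2.1) ∈ spanningTree E ∧ (∀ v, P ((C.label l).star v)) →
      R (∑ v, f (C.star v)) (∑ v, g (C.star v)) := by
    rintro C l ⟨ht, hl⟩
    obtain ⟨r, par, d, h, -⟩ := exists_isRooting ht
    obtain ⟨h1, h2, h3⟩ := (key C l r par d h).1 hl
    rwa [subtreeSums_root h1, subtreeSums_root h2] at h3
  have hcompl : ∀ C : Config E I, C.Admissible N W →
      R (∑ v, f (C.star v)) (∑ v, g (C.star v)) → ∃ l : Fin C.n → J,
      (∀ v, Encodable.encode (l v) ≤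
        Nat.pair (N C.n + 1) (Nat.pair (C.n * B C.n) (C.n * B C.n))) ∧
      ((C.label l).mapInput fun p => p.2.1) ∈ spanningTree E ∧
        ∀ v, P ((C.label l).star v) := by
    intro C hC hRC
    obtain ⟨y, hy⟩ := exists_mem_spanningTree C
    obtain ⟨r, par, d, h, -⟩ := exists_isRooting hy
    obtain ⟨S, hS⟩ := exists_subtreeSums h.depth fun v => f (C.star v)
    obtain ⟨T, hT⟩ := exists_subtreeSums h.depth fun v => g (C.star v)
    have hyN : ∀ v, Encodable.encode (y v) ≤ N C.n + 1 := by
      intro v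
      by_cases hv : v = r
      · rw [show y v = none from hv ▸ h.input_root]
        exact Nat.zero_le _
      · rw [show y v = some (C.ident (par v)) from h.input v hv]
        exact Nat.succ_le_succ (hC.2.1 _)
    refine ⟨fun v => (y v, S v, T v), fun v => pair_le_pair (hyN v) (pair_le_pair ?_ ?_), hy,
      (key C _ r par d h).2 ⟨hS, hT, ?_⟩⟩
    · refine (subtreeSums_le h.depth hS v).trans ?_
      simpa using Finset.sum_le_card_nsmul Finset.univ _ _ fun v _ => hfB C hC v
    · refine (subtreeSums_le h.depth hT v).trans ?_
      simpa using Finset.sum_le_card_nsmul Finset.univ _ _ fun v _ => hgB C hC v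
    · rwa [subtreeSums_root hS, subtreeSums_root hT]
  have hnB := PolyBounded.id.mul hB
  refine ((((certifiable_spanningTree hN).comap (f := fun p : I × J => p.2.1)
    (Primrec.fst.comp Primrec.snd)).and (Certifiable.forall_node hP)).exists_label
    ((hN.add (.const 1)).pair (hnB.pair hnB)) fun C hC l hl => hcompl C hC (hsound C l hl)).congr
    fun C hC => ⟨fun ⟨l, hl⟩ => hsound C l hl, fun h => ?_⟩
  obtain ⟨l, -, hl⟩ := hcompl C hC h
  exact ⟨l, hl⟩

end Sums

/-! ### Hamiltonian cycles as connected graphs of mutual pointers. -/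

/-- The pair `x` of identities contains `i`. -/
def pairHas (x : ℕ × ℕ) (i : ℕ) : Prop := x.1 = i ∨ x.2 = i

/-- The input of `v` consists of the identities of two different neighbours of `v`, whose inputs
mention the identity of `v`. -/
def Config.PairOK (C : Config E (ℕ × ℕ)) (v : Fin C.n) : Prop :=
  ∃ a, C.graph.Adj v a ∧ ∃ b, C.graph.Adj v b ∧ C.ident a ≠ C.ident b ∧
    C.input v = (C.ident a, C.ident b) ∧ pairHas (C.input a) (C.ident v) ∧
    pairHas (C.input b) (C.ident v)

/-- The edges both ends of which mention each other. -/
def Config.mutualGraph (C : Config E (ℕ × ℕ)) : SimpleGraph (Fin C.n) where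
  Adj u v := C.graph.Adj u v ∧ pairHas (C.input u) (C.ident v) ∧ pairHas (C.input v) (C.ident u)
  symm := ⟨fun _ _ h => ⟨h.1.symm, h.2.2, h.2.1⟩⟩

theorem Config.mutualGraph_le (C : Config E (ℕ × ℕ)) : C.mutualGraph ≤ C.graph :=
  fun _ _ h => h.1

/-- A cycle has degree two at each of its nodes, so the two encoded edges are all its edges there.
-/
theorem Config.EncodesCycle.mem_edges_iff {C : Config E (ℕ × ℕ)} {v : Fin C.n}
    {p : C.graph.Walk v v} (hp : p.IsHamiltonianCycle) (h : C.EncodesCycle p) (u w : Fin C.n) :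
    s(u, w) ∈ p.edges ↔ C.graph.Adj u w ∧ pairHas (C.input u) (C.ident w) := by
  obtain ⟨a, b, hab, ha, hb, hi⟩ := h u
  constructor
  · intro hw
    refine ⟨p.adj_of_mem_edges hw, ?_⟩
    have h2 := hp.isCycle.ncard_neighborSet_toSubgraph_eq_two (hp.mem_support u)
    have hsub : ({a, b} : Set (Fin C.n)) ⊆ p.toSubgraph.neighborSet u := by
      rintro x (rfl | rfl)
      · exact SimpleGraph.Walk.adj_toSubgraph_iff_mem_edges.2 ha
      · exact SimpleGraph.Walk.adj_toSubgraph_iff_mem_edges.2 hb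
    have heq := Set.eq_of_subset_of_ncard_le hsub (by rw [h2, Set.ncard_pair hab])
    have : w ∈ ({a, b} : Set (Fin C.n)) := by
      rw [heq]
      exact SimpleGraph.Walk.adj_toSubgraph_iff_mem_edges.2 hw
    rw [hi]
    rcases this with rfl | rfl
    · exact Or.inl rfl
    · exact Or.inr rfl
  · rintro ⟨-, hw⟩
    rw [hi] at hw
    rcases hw with hw | hw
    · rwa [← C.ident_injective hw]
    · rwa [← C.ident_injective hw]

theorem Config.PairOK.neighborSet_mutualGraph {C : Config E (ℕ × ℕ)} {v : Fin C.n}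
    (h : C.PairOK v) : ∃ a b, a ≠ b ∧ C.input v = (C.ident a, C.ident b) ∧
      C.mutualGraph.neighborSet v = {a, b} := by
  obtain ⟨a, ha, b, hb, hab, hi, hav, hbv⟩ := h
  refine ⟨a, b, fun h => hab (h ▸ rfl), hi, ?_⟩
  ext w
  rw [SimpleGraph.mem_neighborSet]
  constructor
  · rintro ⟨-, h, -⟩
    rw [hi] at h
    exact h.imp (fun h => (C.ident_injective h).symm) fun h => (C.ident_injective h).symm
  · rintro (rfl | rfl)
    · exact ⟨ha, hi ▸ Or.inl rfl, hav⟩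
    · exact ⟨hb, hi ▸ Or.inr rfl, hbv⟩

/-- A cycle through `v` fills the component of `v`, here the whole graph, and uses up both edges at
each vertex. -/
theorem exists_isHamiltonianCycle_of_isCycles {V : Type*} [Finite V] [DecidableEq V]
    {G : SimpleGraph V} (hG : G.IsCycles) (hc : G.Connected) (hn : ∀ v, (G.neighborSet v).Nonempty) :
    ∃ (v : V) (p : G.Walk v v), p.IsHamiltonianCycle ∧ ∀ u w, s(u, w) ∈ p.edges ↔ G.Adj u w := by
  have := Fintype.ofFinite V
  classical
  obtain ⟨v⟩ := hc.nonempty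
  obtain ⟨p, hp, hs⟩ := hG.exists_cycle_toSubgraph_verts_eq_connectedComponentSupp
    (c := G.connectedComponentMk v) (v := v) rfl (hn v)
  have hsupp : ∀ u, u ∈ p.toSubgraph.verts := fun u => by
    rw [hs]
    exact SimpleGraph.ConnectedComponent.sound (hc.preconnected u v)
  refine ⟨v, p, SimpleGraph.Walk.isHamiltonianCycle_iff_isCycle_and_support_count_tail_eq_one.2
    ⟨hp, fun u => List.count_eq_one_of_mem hp.support_nodup ?_⟩, fun u w => ?_⟩
  · have hu := p.mem_verts_toSubgraph.1 (hsupp u)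
    rw [← p.cons_tail_support] at hu
    rcases List.mem_cons.1 hu with rfl | hu
    · exact p.end_mem_tail_support hp.not_nil
    · exact hu
  · rw [← SimpleGraph.Walk.adj_toSubgraph_iff_mem_edges]
    exact hp.adj_toSubgraph_iff_of_isCycles hG (hsupp u) w

/-- `Config.PairOK` everywhere makes the mutual graph 2-regular, a disjoint union of cycles;
connectedness leaves just one. -/
theorem mem_hamiltonianCycle_iff (C : Config E (ℕ × ℕ)) :
    C ∈ hamiltonianCycle E ↔ (∀ v, C.PairOK v) ∧ C.mutualGraph.Connected := by
  constructor
  · rintro ⟨v, p, hp, h⟩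
    have hmem := h.mem_edges_iff hp
    have hmut : ∀ e ∈ p.edges, e ∈ C.mutualGraph.edgeSet := by
      intro e
      induction e with
      | h a b =>
        intro he
        obtain ⟨h1, h2⟩ := (hmem a b).1 he
        rw [Sym2.eq_swap] at he
        exact ⟨h1, h2, ((hmem b a).1 he).2⟩
    refine ⟨fun u => ?_, ?_⟩
    · obtain ⟨a, b, hab, ha, hb, hi⟩ := h u
      obtain ⟨h1, -, h2⟩ := hmut _ ha
      obtain ⟨h3, -, h4⟩ := hmut _ hb
      exact ⟨a, h1, b, h3, fun h => hab (C.ident_injective h), hi, h2, h4⟩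
    · have hr : ∀ u, C.mutualGraph.Reachable v u := by
        intro u
        have hu := hp.mem_support u
        rw [← p.support_transfer hmut] at hu
        exact ⟨(p.transfer _ hmut).takeUntil u hu⟩
      have : Nonempty (Fin C.n) := ⟨v⟩
      exact ⟨fun u w => (hr u).symm.trans (hr w)⟩
  · rintro ⟨hok, hc⟩
    obtain ⟨v, p, hp, hmem⟩ := exists_isHamiltonianCycle_of_isCycles
      (G := C.mutualGraph) (fun v _ => by
        obtain ⟨a, b, hab, -, h⟩ := (hok v).neighborSet_mutualGraph
        rw [h, Set.ncard_pair hab]) hc (fun v => by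
        obtain ⟨a, b, hab, -, h⟩ := (hok v).neighborSet_mutualGraph
        exact h ▸ ⟨a, Or.inl rfl⟩)
    refine ⟨v, p.mapLe C.mutualGraph_le, ?_, fun u => ?_⟩
    · rw [SimpleGraph.Walk.isHamiltonianCycle_iff_isCycle_and_length_eq] at hp ⊢
      exact ⟨(SimpleGraph.Walk.isCycle_mapLe _).2 hp.1, by
        rw [SimpleGraph.Walk.length_mapLe, hp.2]⟩
    · obtain ⟨a, b, hab, hi, h⟩ := (hok u).neighborSet_mutualGraph
      refine ⟨a, b, hab, ?_, ?_, hi⟩ <;> rw [SimpleGraph.Walk.edges_mapLe_eq_edges, hmem,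
        ← SimpleGraph.mem_neighborSet, h]
      · exact Or.inl rfl
      · exact Or.inr rfl

theorem exists_encodesCycle (C : Config E I) {v : Fin C.n} {p : C.graph.Walk v v}
    (hp : p.IsHamiltonianCycle) : ∃ x : Fin C.n → ℕ × ℕ, (C.setInput x).EncodesCycle p := by
  have : ∀ u, ∃ y : ℕ × ℕ, ∃ a b, a ≠ b ∧ s(u, a) ∈ p.edges ∧ s(u, b) ∈ p.edges ∧
      y = (C.ident a, C.ident b) := by
    intro u
    obtain ⟨a, b, hab, h⟩ := Set.ncard_eq_two.1
      (hp.isCycle.ncard_neighborSet_toSubgraph_eq_two (hp.mem_support u))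
    refine ⟨_, a, b, hab, ?_, ?_, rfl⟩ <;>
      rw [← SimpleGraph.Walk.adj_toSubgraph_iff_mem_edges, ← SimpleGraph.Subgraph.mem_neighborSet, h]
    · exact Or.inl rfl
    · exact Or.inr rfl
  choose x hx using this
  exact ⟨x, hx⟩

/-- The condition `Config.PairOK` in terms of the star of the node. -/
def starPairOK (s : Star E (ℕ × ℕ)) : Prop :=
  ∃ p ∈ s.2, ∃ q ∈ s.2, p.2.1 ≠ q.2.1 ∧ s.1.2 = (p.2.1, q.2.1) ∧ pairHas p.2.2 s.1.1 ∧
    pairHas q.2.2 s.1.1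

theorem starPairOK_star (C : Config E (ℕ × ℕ)) (v : Fin C.n) :
    starPairOK (C.star v) ↔ C.PairOK v := by
  simp only [starPairOK, Config.exists_mem_star]
  rfl

theorem Config.not_mutualGraph_connected_iff (C : Config E (ℕ × ℕ)) :
    ¬ C.mutualGraph.Connected ↔ ∃ l : Fin C.n → Bool, ((∃ v, l v = true) ∧ ∃ v, l v = false) ∧
      ∀ v u, C.graph.Adj v u →
        pairHas (C.input v) (C.ident u) ∧ pairHas (C.input u) (C.ident v) → l v = l u := by
  constructor
  · intro h
    have : ∃ u v, ¬ C.mutualGraph.Reachable u v := by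
      by_contra! h'
      have := C.connected.nonempty
      exact h ⟨h'⟩
    obtain ⟨u, v, huv⟩ := this
    classical
    -- Colour the component of `u` against the rest.
    refine ⟨fun w => decide (C.mutualGraph.Reachable u w), ⟨⟨u, by simp⟩, v, by simpa using huv⟩,
      fun a b hab h => ?_⟩
    have : C.mutualGraph.Adj a b := ⟨hab, h⟩
    exact decide_eq_decide.2 ⟨fun h => h.trans this.reachable, fun h => h.trans this.symm.reachable⟩
  · rintro ⟨l, ⟨⟨u, hu⟩, v, hv⟩, h⟩ hc
    obtain ⟨w⟩ := hc.preconnected u v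
    have : l u = l v := by
      clear hu hv
      induction w with
      | nil => rfl
      | cons h' _ ih => exact (h _ _ h'.1 h'.2).trans ih
    rw [hu, hv] at this
    cases this

/-! ### Certificates for Hamiltonian cycles and for their failure. -/

section Certificates

theorem primrecRel_pairHas : PrimrecRel pairHas :=
  (Primrec.eq.comp (Primrec.fst.comp Primrec.fst) Primrec.snd).or
    (Primrec.eq.comp (Primrec.snd.comp Primrec.fst) Primrec.snd)

variable [Primcodable E] {N W : ℕ → ℕ}

theorem primrecPred_starPairOK : PrimrecPred (starPairOK : Star E (ℕ × ℕ) → Prop) := by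
  let T := (Star E (ℕ × ℕ) × (E × ℕ × ℕ × ℕ)) × (E × ℕ × ℕ × ℕ)
  have hs : Primrec fun t : T => t.1.1 := Primrec.fst.comp Primrec.fst
  have hp : Primrec fun t : T => t.1.2.2 := Primrec.snd.comp (Primrec.snd.comp Primrec.fst)
  have hq : Primrec fun t : T => t.2.2 := Primrec.snd.comp Primrec.snd
  have hi := Primrec.fst.comp (Primrec.fst.comp hs)
  exact primrecPred_exists_mem Primrec.snd (primrecPred_exists_mem (Primrec.snd.comp Primrec.fst)
    ((Primrec.eq.comp (Primrec.fst.comp hp) (Primrec.fst.comp hq)).not.and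
      ((Primrec.eq.comp (Primrec.snd.comp (Primrec.fst.comp hs))
        (Primrec.pair (Primrec.fst.comp hp) (Primrec.fst.comp hq))).and
      ((primrecRel_pairHas.comp (Primrec.snd.comp hp) hi).and
        (primrecRel_pairHas.comp (Primrec.snd.comp hq) hi)))))

/-- The label is the distance to a root inside the mutual graph, with the identity of that root. The
identity is compared along all edges of the connected graph `C.graph`, so that only one node can act
as root. -/
theorem certifiable_mutualGraph_connected (hN : PolyBounded N) :
    Certifiable N W fun C : Config E (ℕ × ℕ) => C.mutualGraph.Connected := by
  let J := (ℕ × ℕ) × ℕ × ℕ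
  let P : Star E J → Prop := fun s =>
    (∀ q ∈ s.2, q.2.2.2.2 = s.1.2.2.2) ∧ ((s.1.2.2.1 = 0 ∧ s.1.1 = s.1.2.2.2) ∨
      ∃ q ∈ s.2, (pairHas s.1.2.1 q.2.1 ∧ pairHas q.2.2.1 s.1.1) ∧ s.1.2.2.1 = q.2.2.2.1 + 1)
  have hP : PrimrecPred P := by
    have hi : Primrec fun s : Star E J => s.1.1 := Primrec.fst.comp Primrec.fst
    have hx : Primrec fun s : Star E J => s.1.2.1 :=
      Primrec.fst.comp (Primrec.snd.comp Primrec.fst)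
    have hl : Primrec fun s : Star E J => s.1.2.2 :=
      Primrec.snd.comp (Primrec.snd.comp Primrec.fst)
    have hq : Primrec fun p : Star E J × (E × ℕ × J) => p.2.2 := Primrec.snd.comp Primrec.snd
    have hl' := Primrec.snd.comp (Primrec.snd.comp hq)
    exact (primrecPred_forall_mem Primrec.snd (Primrec.eq.comp (Primrec.snd.comp hl')
      ((Primrec.snd.comp hl).comp Primrec.fst))).and
      (((Primrec.eq.comp (Primrec.fst.comp hl) (Primrec.const 0)).and
        (Primrec.eq.comp hi (Primrec.snd.comp hl))).or (primrecPred_exists_mem Primrec.snd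
      (((primrecRel_pairHas.comp (hx.comp Primrec.fst) (Primrec.fst.comp hq)).and
        (primrecRel_pairHas.comp (Primrec.fst.comp (Primrec.snd.comp hq))
          (hi.comp Primrec.fst))).and
      (Primrec.eq.comp ((Primrec.fst.comp hl).comp Primrec.fst)
        (Primrec.succ.comp (Primrec.fst.comp hl'))))))
  have key : ∀ (C : Config E (ℕ × ℕ)) (l : Fin C.n → ℕ × ℕ),
      (∀ v, P ((C.label l).star v)) ↔ ∀ v, (∀ u, C.graph.Adj v u → (l u).2 = (l v).2) ∧
        (((l v).1 = 0 ∧ C.ident v = (l v).2) ∨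
          ∃ u, C.mutualGraph.Adj v u ∧ (l v).1 = (l u).1 + 1) :=
    fun C l => forall_congr' fun v => and_congr (Config.forall_mem_star (C.label l) v)
      (or_congr Iff.rfl ((Config.exists_mem_star (C.label l) v).trans
        (exists_congr fun u => and_assoc.symm)))
  have hcompl : ∀ C : Config E (ℕ × ℕ), C.Admissible N W → C.mutualGraph.Connected →
      ∃ l : Fin C.n → ℕ × ℕ, (∀ v, Encodable.encode (l v) ≤ Nat.pair C.n (N C.n)) ∧
        ∀ v, P ((C.label l).star v) := by
    intro C hC h
    obtain ⟨r⟩ := h.nonempty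
    refine ⟨fun v => (C.mutualGraph.dist v r, C.ident r), fun v => pair_le_pair
      (by simpa using (dist_lt_card h v r).le) (hC.2.1 r),
      (key C _).2 fun v => ⟨fun _ _ => rfl, ?_⟩⟩
    by_cases hv : v = r
    · rw [hv]
      exact Or.inl ⟨SimpleGraph.dist_self, rfl⟩
    · exact Or.inr (exists_adj_dist_succ h hv)
  have hsound : ∀ (C : Config E (ℕ × ℕ)) (l : Fin C.n → ℕ × ℕ),
      (∀ v, P ((C.label l).star v)) → C.mutualGraph.Connected := by
    intro C l h
    rw [key] at h
    have : Nonempty (Fin C.n) := C.connected.nonempty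
    obtain ⟨r, -, hr⟩ := Finset.exists_min_image Finset.univ (fun v => (l v).1)
      Finset.univ_nonempty
    have hroot : (l r).1 = 0 ∧ C.ident r = (l r).2 := by
      rcases (h r).2 with h | ⟨u, -, hu⟩
      · exact h
      · have := hr u (Finset.mem_univ _)
        omega
    have hR := C.eq_of_adj_imp_eq (f := fun v => (l v).2) fun u v huv => ((h u).1 v huv).symm
    have key : ∀ k v, (l v).1 = k → C.mutualGraph.Reachable v r := by
      intro k
      induction k with
      | zero =>
        intro v hk
        rcases (h v).2 with ⟨-, h'⟩ | ⟨u, -, h'⟩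
        · have : v = r := C.ident_injective (by
            rw [h', hroot.2]
            exact hR v r)
          rw [this]
        · omega
      | succ k ih =>
        intro v hk
        rcases (h v).2 with ⟨h', -⟩ | ⟨u, hu, h'⟩
        · omega
        · exact hu.reachable.trans (ih u (by omega))
    exact ⟨fun u v => (key _ u rfl).trans (key _ v rfl).symm⟩
  refine ((Certifiable.forall_node hP).exists_label (PolyBounded.id.pair hN)
    fun C hC l hl => hcompl C hC (hsound C l hl)).congr fun C hC =>
      ⟨fun ⟨l, hl⟩ => hsound C l hl, fun h => ?_⟩
  obtain ⟨l, -, hl⟩ := hcompl C hC h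
  exact ⟨l, hl⟩

theorem certifiable_not_mutualGraph_connected :
    Certifiable N W fun C : Config E (ℕ × ℕ) => ¬ C.mutualGraph.Connected := by
  let J := (ℕ × ℕ) × Bool
  have hi : Primrec fun s : Star E J => s.1.1 := Primrec.fst.comp Primrec.fst
  have hx : Primrec fun s : Star E J => s.1.2.1 :=
    Primrec.fst.comp (Primrec.snd.comp Primrec.fst)
  have hl : Primrec fun s : Star E J => s.1.2.2 :=
    Primrec.snd.comp (Primrec.snd.comp Primrec.fst)
  have hq : Primrec fun p : Star E J × (E × ℕ × J) => p.2.2 := Primrec.snd.comp Primrec.snd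
  have h1 := fun b => Certifiable.exists_node (N := N) (W := W)
    (P := fun s : Star E J => s.1.2.2 = b) (Primrec.eq.comp hl (Primrec.const b))
  have h2 := Certifiable.forall_node (N := N) (W := W)
    (P := fun s : Star E J => ∀ q ∈ s.2, pairHas s.1.2.1 q.2.1 ∧ pairHas q.2.2.1 s.1.1 →
      s.1.2.2 = q.2.2.2)
    (primrecPred_forall_mem Primrec.snd (primrecPred_imp
      ((primrecRel_pairHas.comp (hx.comp Primrec.fst) (Primrec.fst.comp hq)).and
        (primrecRel_pairHas.comp (Primrec.fst.comp (Primrec.snd.comp hq)) (hi.comp Primrec.fst)))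
      (Primrec.eq.comp (hl.comp Primrec.fst) (Primrec.snd.comp (Primrec.snd.comp hq)))))
  refine (((h1 true).and (h1 false)).and h2).exists_bool.congr fun C _ => ?_
  rw [C.not_mutualGraph_connected_iff]
  exact exists_congr fun l => and_congr Iff.rfl (forall_congr' fun v =>
    Config.forall_mem_star (C.label l) v)

theorem certifiable_hamiltonianCycle (hN : PolyBounded N) :
    Certifiable N W (· ∈ hamiltonianCycle E) := by
  refine ((Certifiable.forall_node primrecPred_starPairOK).and
    (certifiable_mutualGraph_connected hN)).congr fun C _ => ?_
  rw [mem_hamiltonianCycle_iff]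
  simp only [starPairOK_star]

theorem certifiable_not_hamiltonianCycle : Certifiable N W (· ∉ hamiltonianCycle E) := by
  refine ((Certifiable.exists_node primrecPred_starPairOK.not).or
    certifiable_not_mutualGraph_connected).congr fun C _ => ?_
  rw [mem_hamiltonianCycle_iff, not_and_or, not_forall]
  simp only [starPairOK_star]

end Certificates

/-! ### Optimal solutions for costs that are sums over nodes. -/

/-- The total weight of the edges at the centre of the star whose other ends are selected by the
input of the centre. -/
def starCost (sel : I → ℕ → Bool) (s : Star ℕ I) : ℕ :=
  (s.2.map fun q => bif sel s.1.2 q.2.1 then q.1 else 0).sum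

/-- The sum of `starCost` over all nodes. -/
noncomputable def Config.cost (sel : I → ℕ → Bool) (C : Config ℕ I) : ℕ :=
  ∑ v, starCost sel (C.star v)

open Classical in
theorem Config.starCost_eq (sel : I → ℕ → Bool) (C : Config ℕ I) (v : Fin C.n) :
    starCost sel (C.star v) =
      ∑ u, if C.graph.Adj v u ∧ sel (C.input v) (C.ident u) = true then C.edgeData s(v, u)
        else 0 := by
  refine (C.sum_star v _).trans (Finset.sum_congr rfl fun u _ => ?_)
  by_cases h : C.graph.Adj v u
  · cases h' : sel (C.input v) (C.ident u) <;> simp [h, h', Config.star]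
  · simp [h]

theorem starCost_le {N W : ℕ → ℕ} {sel : I → ℕ → Bool} {C : Config ℕ I} (hC : C.Admissible N W)
    (v : Fin C.n) :
    starCost sel (C.star v) ≤ C.n * W C.n := by
  classical
  rw [Config.starCost_eq]
  refine (Finset.sum_le_card_nsmul Finset.univ _ (W C.n) fun u _ => ?_).trans (by simp)
  split_ifs with h
  · exact hC.2.2 _ h.1
  · exact Nat.zero_le _

section Optimization

variable [Primcodable I] {N W : ℕ → ℕ} {sel : I → ℕ → Bool}

theorem primrec_starCost (hsel : Primrec₂ sel) : Primrec (starCost sel) := by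
  have hq : Primrec fun p : Star ℕ I × (ℕ × ℕ × I) => p.2 := Primrec.snd
  exact primrec_sum_map Primrec.snd (Primrec.cond
    (hsel.comp (Primrec.snd.comp (Primrec.fst.comp Primrec.fst))
      (Primrec.fst.comp (Primrec.snd.comp hq))) (Primrec.fst.comp hq) (Primrec.const 0))

theorem certifiable_cost_rel (hN : PolyBounded N) (hW : PolyBounded W) (hsel : Primrec₂ sel)
    {R : ℕ → ℕ → Prop} (hR : PrimrecRel R) :
    Certifiable N W fun C : Config ℕ (I × I) =>
      R ((C.mapInput Prod.fst).cost sel) ((C.mapInput Prod.snd).cost sel) := by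
  refine (certifiable_sum_rel hN ((primrec_starCost hsel).comp (Star.primrec_map Primrec.fst))
    ((primrec_starCost hsel).comp (Star.primrec_map Primrec.snd)) (PolyBounded.id.mul hW)
    (fun C hC v => ?_) (fun C hC v => ?_) hR).congr fun C _ => ?_
  · rw [← Config.star_mapInput]
    exact starCost_le (C := C.mapInput Prod.fst) hC v
  · rw [← Config.star_mapInput]
    exact starCost_le (C := C.mapInput Prod.snd) hC v
  · simp only [← Config.star_mapInput]
    rfl

variable {L₀ L : Language ℕ I} {B : ℕ → ℕ}

/-- The cheaper solution is itself the guessed label; `hb` bounds its size because it is feasible.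
-/
theorem certifiable_not_optimal [Inhabited I] (hN : PolyBounded N) (hW : PolyBounded W)
    (hsel : Primrec₂ sel) (h : Certifiable N W (· ∈ L₀)) (h' : Certifiable N W (· ∉ L₀))
    (hB : PolyBounded B)
    (hb : ∀ C : Config ℕ I, C.Admissible N W → C ∈ L₀ →
      ∀ v, Encodable.encode (C.input v) ≤ B C.n)
    (hL : ∀ C, C ∈ L ↔ C ∈ L₀ ∧
      ∀ x : Fin C.n → I, C.setInput x ∈ L₀ → C.cost sel ≤ (C.setInput x).cost sel) :
    Certifiable N W (· ∈ Lᶜ) := by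
  refine (h'.or (((h.comap (f := Prod.snd (α := I)) Primrec.snd).and
    (certifiable_cost_rel hN hW hsel (R := fun a b => b < a)
      (Primrec.nat_lt.comp Primrec.snd Primrec.fst))).exists_label hB fun C hC l hl =>
        ⟨l, hb (C.setInput l) hC hl.1, hl⟩)).congr fun C _ => ?_
  rw [Set.mem_compl_iff, hL, not_and_or]
  push Not
  rfl

theorem optimal_mem_piClass_two [Inhabited I] {X : ℕ → ℕ} (hN : PolyBounded N)
    (hW : PolyBounded W) (hsel : Primrec₂ sel) (h : Certifiable N W (· ∈ L₀))
    (h' : Certifiable N W (· ∉ L₀)) (hB : PolyBounded B)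
    (hb : ∀ C : Config ℕ I, C.Admissible N W → C ∈ L₀ →
      ∀ v, Encodable.encode (C.input v) ≤ B C.n)
    (hL : ∀ C, C ∈ L ↔ C ∈ L₀ ∧
      ∀ x : Fin C.n → I, C.setInput x ∈ L₀ → C.cost sel ≤ (C.setInput x).cost sel)
    {P₁ : I → Prop} (hP₁ : PrimrecPred P₁)
    (h₁ : ∀ C ∈ boundedInstances ℕ I N X W, C.n = 1 → (C ∈ L ↔ ∀ v, P₁ (C.input v))) :
    L ∈ PiClass (boundedInstances ℕ I N X W) 2 := by
  refine mem_piClass_two ((h.comap (f := Prod.fst (β := I)) Primrec.fst).and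
    ((h'.comap (f := Prod.snd (α := I)) Primrec.snd).or
      (certifiable_cost_rel hN hW hsel Primrec.nat_le)))
      (hB.add (.const (Encodable.encode (default : I)))) (fun C _ hC l => ?_)
      (fun C hC hl => ?_) hP₁ h₁
  · rw [hL] at hC
    exact ⟨hC.1, not_or_of_imp (hC.2 l)⟩
  · rw [hL]
    have hmem : ∀ l : Fin C.n → I, C.setInput l ∈ L₀ →
        C ∈ L₀ ∧ C.cost sel ≤ (C.setInput l).cost sel := by
      intro l hl₀
      obtain ⟨h1, h2⟩ := hl l fun v =>
        (hb (C.setInput l) hC hl₀ v).trans (Nat.le_add_right _ _)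
      exact ⟨h1, h2.resolve_left (not_not_intro hl₀)⟩
    refine ⟨?_, fun l hl₀ => (hmem l hl₀).2⟩
    -- A reply to any challenge certifies feasibility of the input. The constant `default` is a
    -- challenge always available, since its code was added to the bound.
    exact (hl (fun _ => default) fun _ => Nat.le_add_left _ _).1

end Optimization

/-! ### Minimum spanning trees. -/

section Mst

/-- The input points to the identity `i` of the parent. -/
def selParent (x : Option ℕ) (i : ℕ) : Bool := decide (x = some i)

theorem primrec_selParent : Primrec₂ selParent :=
  (Primrec.eq.comp Primrec.fst (Primrec.option_some.comp Primrec.snd)).decide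

/-- Every node but the root pays for the edge to its parent. These edges are distinct by depth, and
there are n - 1 of them, hence all of `T`. -/
theorem cost_eq_treeWeight {C : Config ℕ (Option ℕ)} {T : SimpleGraph (Fin C.n)}
    (hT : C.IsSpanningTree T) (h : C.EncodesTree T) : C.cost selParent = C.treeWeight T := by
  classical
  obtain ⟨r, par, hR, hadj⟩ := h.exists_isRooting hT
  have hinj : Set.InjOn (fun v => s(v, par v)) (Finset.univ.erase r : Finset (Fin C.n)) := by
    intro u hu v hv huv
    have hu' := hR.depth u (by simpa using hu)
    have hv' := hR.depth v (by simpa using hv)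
    rcases Sym2.eq_iff.1 huv with h | ⟨h1, h2⟩
    · exact h.1
    · rw [h2] at hu'
      rw [← h1] at hv'
      omega
  have hedges : T.edgeFinset = (Finset.univ.erase r).image fun v => s(v, par v) := by
    symm
    refine Finset.eq_of_subset_of_card_le (fun e he => ?_) ?_
    · obtain ⟨v, hv, rfl⟩ := Finset.mem_image.1 he
      rw [SimpleGraph.mem_edgeFinset]
      exact hadj v (by simpa using hv)
    · have := hT.2.card_edgeFinset
      rw [Finset.card_image_of_injOn hinj, Finset.card_erase_of_mem (Finset.mem_univ r),
        Finset.card_univ]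
      have : T.edgeFinset.card + 1 = Fintype.card (Fin C.n) := by convert this
      omega
  have hw : C.treeWeight T = ∑ v ∈ Finset.univ.erase r, C.edgeData s(v, par v) := by
    rw [← Finset.sum_image (g := fun v => s(v, par v)) (f := C.edgeData) hinj, ← hedges]
    unfold Config.treeWeight
    congr!
  rw [hw, Config.cost]
  symm
  refine Finset.sum_subset_zero_on_sdiff (Finset.subset_univ _) (fun v hv => ?_) fun v hv => ?_
  · obtain rfl : v = r := by simpa using hv
    simp [Config.starCost_eq, hR.input_root, selParent]
  · have hv : v ≠ r := by simpa using hv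
    rw [Config.starCost_eq]
    have : ∀ u, (C.graph.Adj v u ∧ selParent (C.input v) (C.ident u) = true) ↔ u = par v := by
      intro u
      rw [selParent, hR.input v hv, decide_eq_true_eq, Option.some_inj, C.ident_injective.eq_iff]
      exact ⟨fun h => h.2.symm, fun h => ⟨h ▸ hR.adj v hv, h.symm⟩⟩
    simp [this]

theorem mem_mst_iff (C : Config ℕ (Option ℕ)) :
    C ∈ mst ↔ C ∈ spanningTree ℕ ∧ ∀ x : Fin C.n → Option ℕ, C.setInput x ∈ spanningTree ℕ →
      C.cost selParent ≤ (C.setInput x).cost selParent := by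
  constructor
  · rintro ⟨T, hT, h, hmin⟩
    refine ⟨⟨T, hT, h⟩, fun x ⟨T', hT', h'⟩ => ?_⟩
    rw [cost_eq_treeWeight hT h, cost_eq_treeWeight hT' h']
    exact hmin T' hT'
  · rintro ⟨⟨T, hT, h⟩, hmin⟩
    refine ⟨T, hT, h, fun T' hT' => ?_⟩
    obtain ⟨x, hx⟩ := exists_encodesTree C hT'.2.1
    have hT'' : (C.setInput x).IsSpanningTree T' := hT'
    have := hmin x ⟨T', hT'', hx⟩
    rwa [cost_eq_treeWeight hT h, cost_eq_treeWeight hT'' hx] at this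

end Mst

/-! ### Travelling salesman tours. -/

section Tsp

/-- The input contains the identity `i`. -/
def selPair (x : ℕ × ℕ) (i : ℕ) : Bool := decide (x.1 = i ∨ x.2 = i)

theorem primrec_selPair : Primrec₂ selPair :=
  (show PrimrecRel fun (x : ℕ × ℕ) (i : ℕ) => x.1 = i ∨ x.2 = i from primrecRel_pairHas).decide

theorem sum_sum_mem_eq {V : Type*} [Fintype V] [DecidableEq V] {F : Finset (Sym2 V)}
    (hF : ∀ e ∈ F, ¬ e.IsDiag) (w : Sym2 V → ℕ) :
    (∑ v, ∑ u, if s(v, u) ∈ F then w s(v, u) else 0) = 2 * ∑ e ∈ F, w e := by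
  rw [← Fintype.sum_prod_type' (f := fun v u => if s(v, u) ∈ F then w s(v, u) else 0),
    ← Finset.sum_filter, ← Finset.sum_fiberwise_of_maps_to (t := F)
      (g := fun p : V × V => s(p.1, p.2)) (by simp), Finset.mul_sum]
  refine Finset.sum_congr rfl fun e he => ?_
  have hne := hF e he
  induction e with
  | h a b =>
    rw [Sym2.mk_isDiag_iff] at hne
    have : (Finset.univ.filter fun p : V × V => s(p.1, p.2) ∈ F).filter
        (fun p => s(p.1, p.2) = s(a, b)) = {(a, b), (b, a)} := by
      ext ⟨u, v⟩
      simp only [Finset.mem_filter, Finset.mem_univ, true_and, Finset.mem_insert,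
        Finset.mem_singleton, Prod.mk.injEq, Sym2.eq_iff]
      constructor
      · exact fun h => h.2
      · rintro (⟨rfl, rfl⟩ | ⟨rfl, rfl⟩)
        · exact ⟨he, by simp⟩
        · exact ⟨Sym2.eq_swap ▸ he, by simp⟩
    rw [this, Finset.sum_pair (by simp [hne]), Sym2.eq_swap (a := b), two_mul]

/-- Both ends of an edge pay for it. The factor two does not affect comparisons. -/
theorem cost_eq_walkWeight {C : Config ℕ (ℕ × ℕ)} {v : Fin C.n} {p : C.graph.Walk v v}
    (hp : p.IsHamiltonianCycle) (h : C.EncodesCycle p) :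
    C.cost selPair = 2 * C.walkWeight p := by
  classical
  have hw : C.walkWeight p = ∑ e ∈ p.edges.toFinset, C.edgeData e :=
    (List.sum_toFinset _ hp.isCycle.isTrail.edges_nodup).symm
  rw [hw, ← sum_sum_mem_eq fun e he => C.graph.not_isDiag_of_mem_edgeSet
    (p.edges_subset_edgeSet (List.mem_toFinset.1 he)), Config.cost]
  refine Finset.sum_congr rfl fun a _ => ?_
  rw [Config.starCost_eq]
  refine Finset.sum_congr rfl fun b _ => ?_
  simp only [List.mem_toFinset, h.mem_edges_iff hp, selPair, decide_eq_true_eq, pairHas]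

theorem mem_travellingSalesman_iff (C : Config ℕ (ℕ × ℕ)) :
    C ∈ travellingSalesman ↔ C ∈ hamiltonianCycle ℕ ∧ ∀ x : Fin C.n → ℕ × ℕ,
      C.setInput x ∈ hamiltonianCycle ℕ → C.cost selPair ≤ (C.setInput x).cost selPair := by
  constructor
  · rintro ⟨v, p, hp, h, hmin⟩
    refine ⟨⟨v, p, hp, h⟩, fun x ⟨u, q, hq, h'⟩ => ?_⟩
    rw [cost_eq_walkWeight hp h, cost_eq_walkWeight hq h']
    exact Nat.mul_le_mul_left 2 (hmin u q hq)
  · rintro ⟨⟨v, p, hp, h⟩, hmin⟩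
    refine ⟨v, p, hp, h, fun u q hq => ?_⟩
    obtain ⟨x, hx⟩ := exists_encodesCycle C hq
    have := hmin x ⟨u, q, hq, hx⟩
    rw [cost_eq_walkWeight hp h, cost_eq_walkWeight (C := C.setInput x) hq hx] at this
    exact Nat.le_of_mul_le_mul_left this two_pos

end Tsp

/-! ### Graphs with a single node. -/

section OneNode

theorem Config.subsingleton (C : Config E I) (h : C.n = 1) : Subsingleton (Fin C.n) :=
  Fin.subsingleton_iff_le_one.2 h.le

theorem mem_compl_iff_of_one_node {C : Config E I} (h : C.n = 1) {L : Language E I} {P : I → Prop}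
    (hL : C ∈ L ↔ ∀ v, P (C.input v)) : C ∈ Lᶜ ↔ ∀ v, ¬ P (C.input v) := by
  have := C.subsingleton h
  obtain ⟨v⟩ := C.connected.nonempty
  rw [Set.mem_compl_iff, hL, not_forall]
  exact ⟨fun ⟨w, hw⟩ u => Subsingleton.elim w u ▸ hw, fun h => ⟨v, h v⟩⟩

theorem mem_spanningTree_of_one_node {C : Config E (Option ℕ)} (h : C.n = 1) :
    C ∈ spanningTree E ↔ ∀ v, C.input v = none := by
  have := C.subsingleton h
  constructor
  · intro hC v
    obtain ⟨r, par, d, hR, -⟩ := exists_isRooting hC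
    rw [Subsingleton.elim v r]
    exact hR.input_root
  · intro hC
    obtain ⟨r⟩ := C.connected.nonempty
    exact Config.IsRooting.mem_spanningTree (r := r) (par := id) (d := fun _ => 0)
      ⟨hC r, rfl, fun v hv => absurd (Subsingleton.elim v r) hv,
        fun v hv => absurd (Subsingleton.elim v r) hv,
        fun v hv => absurd (Subsingleton.elim v r) hv⟩

theorem mem_mst_of_one_node {C : Config ℕ (Option ℕ)} (h : C.n = 1) :
    C ∈ mst ↔ ∀ v, C.input v = none := by
  have := C.subsingleton h
  have hcost : C.cost selParent = 0 := by
    classical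
    refine Finset.sum_eq_zero fun v _ => ?_
    rw [Config.starCost_eq]
    refine Finset.sum_eq_zero fun u _ => if_neg fun h => ?_
    exact h.1.ne (Subsingleton.elim v u)
  rw [mem_mst_iff, mem_spanningTree_of_one_node h, hcost]
  exact and_iff_left fun _ _ => Nat.zero_le _

theorem mem_hamiltonianCycle_of_one_node {C : Config E (ℕ × ℕ)} (h : C.n = 1) :
    C ∈ hamiltonianCycle E ↔ ∀ v, (fun _ => False) (C.input v) := by
  have := C.subsingleton h
  obtain ⟨v⟩ := C.connected.nonempty
  refine ⟨fun hC => ?_, fun hC => (hC v).elim⟩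
  obtain ⟨a, ha, -⟩ := ((mem_hamiltonianCycle_iff C).1 hC).1 v
  exact (ha.ne (Subsingleton.elim v a)).elim

theorem mem_travellingSalesman_of_one_node {C : Config ℕ (ℕ × ℕ)} (h : C.n = 1) :
    C ∈ travellingSalesman ↔ ∀ v, (fun _ => False) (C.input v) := by
  obtain ⟨v⟩ := C.connected.nonempty
  refine ⟨fun hC => ?_, fun hC => (hC v).elim⟩
  exact (mem_hamiltonianCycle_of_one_node h).1 ((mem_travellingSalesman_iff C).1 hC).1

end OneNode

/-! ### Feasible inputs have polynomial size. -/

section Bounds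

variable [Primcodable E] {N W : ℕ → ℕ}

theorem encode_input_le_of_mem_spanningTree {C : Config E (Option ℕ)} (hC : C.Admissible N W)
    (h : C ∈ spanningTree E) (v : Fin C.n) : Encodable.encode (C.input v) ≤ N C.n + 1 := by
  obtain ⟨r, par, d, hR, -⟩ := exists_isRooting h
  by_cases hv : v = r
  · rw [hv, hR.input_root]
    exact Nat.zero_le _
  · rw [hR.input v hv]
    exact Nat.succ_le_succ (hC.2.1 _)

theorem encode_input_le_of_mem_hamiltonianCycle {C : Config E (ℕ × ℕ)} (hC : C.Admissible N W)
    (h : C ∈ hamiltonianCycle E) (v : Fin C.n) :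
    Encodable.encode (C.input v) ≤ Nat.pair (N C.n) (N C.n) := by
  obtain ⟨a, -, b, -, -, hi, -⟩ := ((mem_hamiltonianCycle_iff C).1 h).1 v
  rw [hi]
  exact pair_le_pair (hC.2.1 a) (hC.2.1 b)

end Bounds

/-! ### Unfolding the classes at levels one and two. -/

section Classes

variable [Primcodable E] [Primcodable I] {𝓘 : Set (Config E I)} {L : Language E I}

theorem mem_lambdaClass_one : L ∈ LambdaClass 𝓘 1 ↔ L ∈ SigmaClass 𝓘 1 := by
  rw [LambdaClass, if_pos odd_one]

theorem mem_coLambdaClass_one : L ∈ coLambdaClass 𝓘 1 ↔ Lᶜ ∈ SigmaClass 𝓘 1 :=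
  mem_lambdaClass_one

theorem mem_lambdaClass_two : L ∈ LambdaClass 𝓘 2 ↔ L ∈ PiClass 𝓘 2 := by
  rw [LambdaClass, if_neg (by decide)]

theorem primrecPred_false : PrimrecPred fun _ : I => False :=
  ⟨inferInstance, Primrec.const false⟩

theorem primrecPred_eq_none : PrimrecPred fun x : Option ℕ => x = none :=
  Primrec.eq.comp Primrec.id (Primrec.const none)

end Classes

end LocalDecision

/-! ### The corollary. -/

open LocalDecision in
theorem mainTheorem1 (N X W : ℕ → ℕ) (hN : LocalDecision.PolyBounded N)
    (hX : LocalDecision.PolyBounded X) (hW : LocalDecision.PolyBounded W) :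
    (LocalDecision.mst ∈
        LocalDecision.coLambdaClass (LocalDecision.boundedInstances ℕ (Option ℕ) N X W) 1 ∧
      LocalDecision.travellingSalesman ∈
        LocalDecision.coLambdaClass (LocalDecision.boundedInstances ℕ (ℕ × ℕ) N X W) 1) ∧
    (LocalDecision.mst ∈
        LocalDecision.LambdaClass (LocalDecision.boundedInstances ℕ (Option ℕ) N X W) 2 ∧
      LocalDecision.travellingSalesman ∈
        LocalDecision.LambdaClass (LocalDecision.boundedInstances ℕ (ℕ × ℕ) N X W) 2) ∧
    (LocalDecision.spanningTree Unit ∈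
        LocalDecision.LambdaClass (LocalDecision.boundedInstances Unit (Option ℕ) N X W) 1 ∩
        LocalDecision.coLambdaClass (LocalDecision.boundedInstances Unit (Option ℕ) N X W) 1 ∧
      LocalDecision.hamiltonianCycle Unit ∈
        LocalDecision.LambdaClass (LocalDecision.boundedInstances Unit (ℕ × ℕ) N X W) 1 ∩
        LocalDecision.coLambdaClass (LocalDecision.boundedInstances Unit (ℕ × ℕ) N X W) 1) := by
  -- Bounds on feasible inputs: `some i` has code i + 1, a pair of identities the code `Nat.pair`.
  have hN1 := hN.add (.const 1)
  have hNN := hN.pair hN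
  simp only [mem_coLambdaClass_one, mem_lambdaClass_one, mem_lambdaClass_two, Set.mem_inter_iff]
  refine ⟨⟨?_, ?_⟩, ⟨?_, ?_⟩, ⟨?_, ?_⟩, ?_, ?_⟩
  · exact mem_sigmaClass_one (certifiable_not_optimal hN hW primrec_selParent
      (certifiable_spanningTree hN) certifiable_not_spanningTree hN1
      (fun _ => encode_input_le_of_mem_spanningTree) mem_mst_iff) primrecPred_eq_none.not
      fun C _ hn => mem_compl_iff_of_one_node hn (P := fun x => x = none) (mem_mst_of_one_node hn)
  · exact mem_sigmaClass_one (certifiable_not_optimal hN hW primrec_selPair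
      (certifiable_hamiltonianCycle hN) certifiable_not_hamiltonianCycle hNN
      (fun _ => encode_input_le_of_mem_hamiltonianCycle) mem_travellingSalesman_iff)
      primrecPred_false.not
      fun C _ hn => mem_compl_iff_of_one_node hn (P := fun _ => False)
        (mem_travellingSalesman_of_one_node hn)
  · exact optimal_mem_piClass_two hN hW primrec_selParent
      (certifiable_spanningTree hN) certifiable_not_spanningTree hN1
      (fun _ => encode_input_le_of_mem_spanningTree) mem_mst_iff primrecPred_eq_none
      fun C _ hn => mem_mst_of_one_node hn
  · exact optimal_mem_piClass_two hN hW primrec_selPair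
      (certifiable_hamiltonianCycle hN) certifiable_not_hamiltonianCycle hNN
      (fun _ => encode_input_le_of_mem_hamiltonianCycle) mem_travellingSalesman_iff
      primrecPred_false fun C _ hn => mem_travellingSalesman_of_one_node hn
  · exact mem_sigmaClass_one (certifiable_spanningTree hN) primrecPred_eq_none
      fun C _ hn => mem_spanningTree_of_one_node hn
  · exact mem_sigmaClass_one certifiable_not_spanningTree primrecPred_eq_none.not
      fun C _ hn => mem_compl_iff_of_one_node hn (P := fun x => x = none)
        (mem_spanningTree_of_one_node hn)
  · exact mem_sigmaClass_one (certifiable_hamiltonianCycle hN) primrecPred_false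
      fun C _ hn => mem_hamiltonianCycle_of_one_node hn
  · exact mem_sigmaClass_one certifiable_not_hamiltonianCycle primrecPred_false.not
      fun C _ hn => mem_compl_iff_of_one_node hn (P := fun _ => False)
        (mem_hamiltonianCycle_of_one_node hn)
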